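/- **Conventions.** Let $G$ be a group with a finite generating family $s=(s_1,\dots,s_m)$; let $|g|$ be the length of a shortest word in the letters $s_i^{\pm1}$ representing $g$, and $d(x,y)=|x^{-1}y|$ the word metric. For $g\in G$ of infinite order, the stable norm is $[[g]]=\lim_{n\to\infty}|g^n|/n$. For $\delta\ge 0$, $G$ is $\delta$-hyperbolic (with respect to $s$) if $(x|z)_w\ge\min\{(x|y)_w,(y|z)_w\}-\delta$ for all $x,y,z,w\in G$, where $(x|y)_w=\frac12(d(x,w)+d(y,w)-d(x,y))$; $G$ is word hyperbolic if it is $\delta$-hyperbolic for some $\delta$, which may be taken to be a natural number. An edge path $p_0,\dots,p_n$ in the Cayley graph is a $k$-local geodesic if each of its subpaths (between vertices) of length at most $k$ is geodesic, and a $(\lambda,\varepsilon)$-quasigeodesic if $j-i\le\lambda\, d(p_i,p_j)+\varepsilon$ and $d(p_i,p_j)\le\lambda(j-i)+\varepsilon$ for all $0\le i\le j\le n$. Call $(k,\lambda,\varepsilon)$, with $k\ge1$ an integer and $\lambda\ge1$, $\varepsilon\ge0$ real, *admissible* for $(G,s)$ if every $k$-local geodesic in the Cayley graph is a $(\lambda,\varepsilon)$-quasigeodesic.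 A word is cyclically reduced if all its cyclic conjugates are geodesic words. A *cyclic reduction* $\rho$ assigns to every $g\in G$ a cyclically reduced word $\rho(g)$ representing a conjugate of $g$. Given $k$ and $\rho$, the *search* at $g$ examines $i=2,3,\dots$ in turn: if $\rho(g^i)$ has length at least $k$, it stops and returns $n_g=i$; if $\rho(g^i)$ is empty, it stops and returns nothing; otherwise it goes on to $i+1$. Let $n_{\max}=n_{\max}(k,\rho)$ be the largest of the numbers $n_g$ returned for the elements $g$ with $|g|\le k-1$, and $n_{\max}=1$ if none is returned. **Theorem.** There are computable functions $k,\lambda,\varepsilon:\mathbb N\to\mathbb N$ with $k(\delta)\ge1$ and $\lambda(\delta)\ge1$, and an algorithm (a partial recursive function) $\mathcal K$, such that for every group $G$ with a finite generating family $s=(s_1,\dots,s_m)$ and every $\delta\in\mathbb N$ for which $G$ is $\delta$-hyperbolic with respect to $s$, the following hold. 1. The limit defining $[[g]]$ exists for every $g\in G$ of infinite order. 2. The triple $(k(\delta),\lambda(\delta),\varepsilon(\delta))$ is admissible for $(G,s)$. 3. The word problem of $G$ with respect to $s$ is solvable. Given $m$, $\delta$ and any program that solves it, $\mathcal K$ halts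 and outputs a fraction $K>0$ such that $[[g]]\ge K$ for every $g\in G$ of infinite order; moreover $K=\dfrac{k(\delta)}{\lambda(\delta)\,n_{\max}(k(\delta),\rho)}$ for some cyclic reduction $\rho$. 4. For every admissible triple $(k,\lambda,\varepsilon)$ and every cyclic reduction $\rho$: the search terminates at every $g$ with $|g|\le k-1$, and it returns a number $n_g$ if and only if $g$ has infinite order; $n_{\max}=n_{\max}(k,\rho)$ is finite; and every $g\in G$ of infinite order satisfies $$[[g]]\ \ge\ \frac{k}{\lambda\,n_{\max}}\ >\ 0 .$$ -/

import Mathlib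

open Filter Topology

namespace WordHyp

/-! Words, word length and word metric of a group `G` with a finite generating family `s`. -/

/-- Words on `S ∪ S⁻¹`: the letter `(i, true)` stands for the generator `s i`,
the letter `(i, false)` for its inverse. -/
abbrev Word (m : ℕ) := List (Fin m × Bool)

/-- The element of `G` represented by a letter. -/
def letterEval {G : Type*} [Group G] {m : ℕ} (s : Fin m → G) (a : Fin m × Bool) : G :=
  if a.2 then s a.1 else (s a.1)⁻¹

/-- The element of `G` represented by a word. -/
def wordEval {G : Type*} [Group G] {m : ℕ} (s : Fin m → G) (w : Word m) : G :=
  (w.map (letterEval s)).prod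

/-- `|g|`: the least length of a word representing `g`. -/
noncomputable def wordLength {G : Type*} [Group G] {m : ℕ} (s : Fin m → G) (g : G) : ℕ :=
  sInf {n : ℕ | ∃ w : Word m, w.length = n ∧ wordEval s w = g}

/-- The word metric `d(x, y) = |x⁻¹ y|`. -/
noncomputable def wordDist {G : Type*} [Group G] {m : ℕ} (s : Fin m → G) (x y : G) : ℕ :=
  wordLength s (x⁻¹ * y)

/-- The stable norm `[[g]] = lim |g ^ n| / n`. -/
noncomputable def stableNorm {G : Type*} [Group G] {m : ℕ} (s : Fin m → G) (g : G) : ℝ :=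
  limUnder atTop (fun n : ℕ => (wordLength s (g ^ n) : ℝ) / n)

/-! Hyperbolicity. -/

/-- The Gromov product `(x | y)_w` for the word metric. -/
noncomputable def gromovProduct {G : Type*} [Group G] {m : ℕ} (s : Fin m → G)
    (x y w : G) : ℝ :=
  ((wordDist s x w : ℝ) + wordDist s y w - wordDist s x y) / 2

/-- `G` with the word metric is a `δ`-hyperbolic metric space. The group is word hyperbolic
if this holds for some `δ`. -/
def IsDeltaHyperbolic {G : Type*} [Group G] {m : ℕ} (s : Fin m → G) (δ : ℝ) : Prop :=
  ∀ x y z w : G,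
    min (gromovProduct s x y w) (gromovProduct s y z w) - δ ≤ gromovProduct s x z w

/-! Paths in the Cayley graph. A path of length `n` is given by its successive vertices
`p 0, …, p n`. -/

/-- `p 0, …, p n` is an edge path in the Cayley graph. -/
def IsEdgePath {G : Type*} [Group G] {m : ℕ} (s : Fin m → G) (n : ℕ) (p : ℕ → G) : Prop :=
  ∀ i < n, ∃ a : Fin m × Bool, p (i + 1) = p i * letterEval s a

/-- Every subpath of length at most `k` is geodesic. -/
def IsLocalGeodesic {G : Type*} [Group G] {m : ℕ} (s : Fin m → G) (k n : ℕ) (p : ℕ → G) :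
    Prop :=
  IsEdgePath s n p ∧
    ∀ i j : ℕ, i ≤ j → j ≤ n → j - i ≤ k → wordDist s (p i) (p j) = j - i

/-- The path `p 0, …, p n`, parametrized by arc length, is a `(lam, eps)`-quasigeodesic. -/
def IsQuasigeodesic {G : Type*} [Group G] {m : ℕ} (s : Fin m → G) (lam eps : ℝ) (n : ℕ)
    (p : ℕ → G) : Prop :=
  ∀ i j : ℕ, i ≤ j → j ≤ n →
    ((j - i : ℕ) : ℝ) ≤ lam * wordDist s (p i) (p j) + eps ∧
      (wordDist s (p i) (p j) : ℝ) ≤ lam * ((j - i : ℕ) : ℝ) + eps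

/-- Every `k`-local geodesic in the Cayley graph is a `(lam, eps)`-quasigeodesic. -/
def LocalGeodesicsQuasi {G : Type*} [Group G] {m : ℕ} (s : Fin m → G) (k : ℕ)
    (lam eps : ℝ) : Prop :=
  ∀ (n : ℕ) (p : ℕ → G), IsLocalGeodesic s k n p → IsQuasigeodesic s lam eps n p

/-! Cyclically reduced words and the search. -/

/-- A word is cyclically reduced if all its cyclic conjugates are geodesic words. -/
def IsCyclicallyReduced {G : Type*} [Group G] {m : ℕ} (s : Fin m → G) (w : Word m) : Prop :=
  ∀ w' : Word m, List.IsRotated w w' → wordLength s (wordEval s w') = w'.length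

/-- `ρ` changes each element into a cyclically reduced word representing a conjugate of it. -/
def IsCyclicReduction {G : Type*} [Group G] {m : ℕ} (s : Fin m → G) (ρ : G → Word m) : Prop :=
  ∀ g : G, IsCyclicallyReduced s (ρ g) ∧ IsConj g (wordEval s (ρ g))

/-- The search at `g` stops when it examines `g ^ i`: the cyclically reduced word obtained from
`g ^ i` has length at least `k`, or is empty. -/
def SearchStopsAt {G : Type*} [Group G] {m : ℕ} (k : ℕ) (ρ : G → Word m) (g : G) (i : ℕ) :
    Prop :=
  k ≤ (ρ (g ^ i)).length ∨ (ρ (g ^ i)).length = 0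

/-- The search at `g`, which examines `g ^ 2, g ^ 3, …` in turn, first stops at `n`, and it does
so with a word of length at least `k`; that is, it returns `n_g = n`. -/
def SearchReturns {G : Type*} [Group G] {m : ℕ} (k : ℕ) (ρ : G → Word m) (g : G) (n : ℕ) :
    Prop :=
  2 ≤ n ∧ k ≤ (ρ (g ^ n)).length ∧ ∀ i : ℕ, 2 ≤ i → i < n → ¬ SearchStopsAt k ρ g i

/-- `N = n_max`: the largest of the numbers `n_g` returned by the search for the elements `g` of
the ball of radius `k - 1` (and `N = 1` if no number is returned). -/
def IsNMax {G : Type*} [Group G] {m : ℕ} (s : Fin m → G) (k : ℕ) (ρ : G → Word m) (N : ℕ) :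
    Prop :=
  IsGreatest ({1} ∪ {n : ℕ | ∃ g : G, wordLength s g ≤ k - 1 ∧ SearchReturns k ρ g n}) N

/-! The word problem. -/

/-- The program `c` solves the word problem: on (the code of) a word it halts with output `1` if
the word represents the neutral element, and with output `0` otherwise. -/
def SolvesWordProblem {G : Type*} [Group G] {m : ℕ} (s : Fin m → G) (c : Nat.Partrec.Code) :
    Prop :=
  ∀ w : Word m,
    (wordEval s w = 1 →
      1 ∈ c.eval (Encodable.encode (w.map fun a => ((a.1 : ℕ), a.2)))) ∧
    (wordEval s w ≠ 1 →
      0 ∈ c.eval (Encodable.encode (w.map fun a => ((a.1 : ℕ), a.2))))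

end WordHyp

open WordHyp

namespace WordHyp

/-! ### Words, word length and the word metric. -/

section Basics

variable {G : Type*} [Group G] {m : ℕ} {s : Fin m → G}

/-! Everything geometric rests on the four-point inequality. By `IsDeltaHyperbolic.chain`, a
sequence of points whose double steps exceed its single steps by more than $2\delta$ moves away from
its start at linear speed. Sampling a local geodesic at regular intervals gives such a sequence, so
`IsDeltaHyperbolic.localGeodesicsQuasi` gets the admissible triple $(8\delta+4, 2, 12\delta+6)$. An
element $h$ of infinite order gives another: some power $f=h^i$ moves an interior point $z$ of a
long geodesic from $1$ to $h^n$ far, while it moves both ends little; then the orbit $f^t z$ is such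
a sequence and $[[h]]>0$ (`IsDeltaHyperbolic.stableNorm_pos`).

Powers of a cyclically reduced word $w$ with $|w|\ge k$ label $k$-local geodesics, so $[[w]]\ge
|w|/\lambda\ge k/\lambda$. The stable norm is a conjugacy invariant and $[[g^n]]=n[[g]]$. Hence
either $\rho(g)$ already has length at least $k$, or $g$ is conjugate to an element $h$ of the ball
of radius $k-1$, and $n_h[[g]]=[[h^{n_h}]]\ge k/\lambda$. This is
`IsDeltaHyperbolic.div_le_stableNorm`. Positivity of $[[g]]$ is what makes the search terminate.

The word problem is solved by replacing short subwords by geodesics until the word is a local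
geodesic; one that represents $1$ has length at most $\varepsilon$, so a finite table decides.

For computability, the statement that $N$ is $n_{\max}$ for some $\rho$ is given finite
certificates, checkable with time-bounded runs of the given program. The algorithm looks through all
candidates. Every certificate is correct (`CertNMax.exists_isNMax`), and one exists
(`IsNMax.exists_certNMax`). -/

@[simp] lemma wordEval_nil : wordEval s [] = 1 := rfl

@[simp] lemma wordEval_cons (a : Fin m × Bool) (w : Word m) :
    wordEval s (a :: w) = letterEval s a * wordEval s w := by
  simp [wordEval]

@[simp] lemma wordEval_append (v w : Word m) :
    wordEval s (v ++ w) = wordEval s v * wordEval s w := by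
  simp [wordEval]

/-- The formal inverse of a word. -/
def wordInv {α : Type*} (w : List (α × Bool)) : List (α × Bool) :=
  (w.map fun a => (a.1, !a.2)).reverse

@[simp] lemma wordInv_length {α : Type*} (w : List (α × Bool)) :
    (wordInv w).length = w.length := by
  simp [wordInv]

@[simp] lemma wordEval_wordInv (w : Word m) : wordEval s (wordInv w) = (wordEval s w)⁻¹ := by
  induction w with
  | nil => simp [wordInv]
  | cons a w ih =>
    have h : wordInv (a :: w) = wordInv w ++ [(a.1, !a.2)] := by simp [wordInv]
    rw [h, wordEval_append, ih, wordEval_cons, wordEval_cons, mul_inv_rev]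
    rcases a with ⟨i, b⟩
    cases b <;> simp [letterEval]

lemma wordLength_wordEval_le (w : Word m) : wordLength s (wordEval s w) ≤ w.length :=
  Nat.sInf_le ⟨w, rfl, rfl⟩

lemma wordLength_one : wordLength s (1 : G) = 0 :=
  Nat.le_zero.1 (wordLength_wordEval_le (s := s) [])

lemma exists_wordEval_eq (hs : Subgroup.closure (Set.range s) = ⊤) (g : G) :
    ∃ w : Word m, wordEval s w = g := by
  have hg : g ∈ Subgroup.closure (Set.range s) := hs ▸ Subgroup.mem_top g
  induction hg using Subgroup.closure_induction with
  | mem x hx =>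
    obtain ⟨i, rfl⟩ := hx
    exact ⟨[(i, true)], by simp [letterEval]⟩
  | one => exact ⟨[], rfl⟩
  | mul x y _ _ hx hy =>
    obtain ⟨v, rfl⟩ := hx
    obtain ⟨w, rfl⟩ := hy
    exact ⟨v ++ w, by simp⟩
  | inv x _ hx =>
    obtain ⟨v, rfl⟩ := hx
    exact ⟨wordInv v, by simp⟩

lemma exists_geodesic_word (hs : Subgroup.closure (Set.range s) = ⊤) (g : G) :
    ∃ w : Word m, w.length = wordLength s g ∧ wordEval s w = g := by
  obtain ⟨w, hw⟩ := exists_wordEval_eq hs g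
  exact Nat.sInf_mem (s := {n : ℕ | ∃ w : Word m, w.length = n ∧ wordEval s w = g})
    ⟨w.length, w, rfl, hw⟩

lemma wordLength_mul_le (hs : Subgroup.closure (Set.range s) = ⊤) (g h : G) :
    wordLength s (g * h) ≤ wordLength s g + wordLength s h := by
  obtain ⟨v, hv, rfl⟩ := exists_geodesic_word hs g
  obtain ⟨w, hw, rfl⟩ := exists_geodesic_word hs h
  rw [← hv, ← hw, ← wordEval_append, ← List.length_append]
  exact wordLength_wordEval_le _

lemma wordLength_inv (hs : Subgroup.closure (Set.range s) = ⊤) (g : G) :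
    wordLength s g⁻¹ = wordLength s g := by
  have key : ∀ x : G, wordLength s x⁻¹ ≤ wordLength s x := fun x => by
    obtain ⟨v, hv, rfl⟩ := exists_geodesic_word hs x
    rw [← hv, ← wordEval_wordInv, ← wordInv_length]
    exact wordLength_wordEval_le _
  exact le_antisymm (key g) (by simpa using key g⁻¹)

lemma finite_ball (hs : Subgroup.closure (Set.range s) = ⊤) (r : ℕ) :
    {g : G | wordLength s g ≤ r}.Finite := by
  refine ((List.finite_length_le (Fin m × Bool) r).image (wordEval s)).subset fun g hg => ?_
  obtain ⟨v, hv, rfl⟩ := exists_geodesic_word hs g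
  exact ⟨v, by simpa [hv] using hg, rfl⟩

lemma wordDist_one_left (g : G) : wordDist s 1 g = wordLength s g := by
  simp [wordDist]

lemma wordDist_self (g : G) : wordDist s g g = 0 := by
  simp [wordDist, wordLength_one]

lemma wordDist_mul_left (f x y : G) : wordDist s (f * x) (f * y) = wordDist s x y := by
  simp [wordDist, mul_assoc]

lemma wordDist_comm (hs : Subgroup.closure (Set.range s) = ⊤) (x y : G) :
    wordDist s x y = wordDist s y x := by
  rw [wordDist, wordDist, ← wordLength_inv hs]
  simp

lemma wordDist_triangle (hs : Subgroup.closure (Set.range s) = ⊤) (x y z : G) :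
    wordDist s x z ≤ wordDist s x y + wordDist s y z := by
  have := wordLength_mul_le hs (x⁻¹ * y) (y⁻¹ * z)
  simpa [wordDist, mul_assoc] using this

lemma IsEdgePath.exists_word {n : ℕ} {p : ℕ → G} (hp : IsEdgePath s n p) (i t : ℕ)
    (h : i + t ≤ n) : ∃ w : Word m, w.length = t ∧ p (i + t) = p i * wordEval s w := by
  induction t with
  | zero => exact ⟨[], by simp⟩
  | succ t ih =>
    obtain ⟨w, hw, h1⟩ := ih (by omega)
    obtain ⟨a, ha⟩ := hp (i + t) (by omega)
    exact ⟨w ++ [a], by simp [hw], by rw [← add_assoc, ha, h1]; simp [mul_assoc]⟩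

lemma IsEdgePath.wordDist_le {n : ℕ} {p : ℕ → G} (hp : IsEdgePath s n p) {i j : ℕ}
    (hij : i ≤ j) (hj : j ≤ n) : wordDist s (p i) (p j) ≤ j - i := by
  obtain ⟨w, hw, h⟩ := hp.exists_word i (j - i) (by omega)
  rw [Nat.add_sub_cancel' hij] at h
  rw [wordDist, h, inv_mul_cancel_left, ← hw]
  exact wordLength_wordEval_le w

lemma geodesic_of_append (hs : Subgroup.closure (Set.range s) = ⊤) {v w : Word m}
    (h : wordLength s (wordEval s (v ++ w)) = (v ++ w).length) :
    wordLength s (wordEval s v) = v.length ∧ wordLength s (wordEval s w) = w.length := by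
  have h1 := wordLength_wordEval_le (s := s) v
  have h2 := wordLength_wordEval_le (s := s) w
  have h3 := wordLength_mul_le hs (wordEval s v) (wordEval s w)
  rw [wordEval_append, List.length_append] at h
  omega

end Basics

/-! ### Consequences of the four-point inequality. -/

section Hyperbolic

variable {G : Type*} [Group G] {m : ℕ} {s : Fin m → G} {δ : ℕ}

/-- Doubling the inequality between Gromov products and cancelling distances to the base point
leaves a statement about natural numbers, suited to linear arithmetic. -/
lemma IsDeltaHyperbolic.four_point
    (hδ : IsDeltaHyperbolic s (δ : ℝ)) (x y z w : G) :
    wordDist s x z + wordDist s y w ≤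
      max (wordDist s x y + wordDist s z w) (wordDist s y z + wordDist s x w) + 2 * δ := by
  have h := hδ x y z w
  simp only [gromovProduct] at h
  rw [← @Nat.cast_le ℝ]
  push_cast
  rcases min_le_iff.1 (sub_le_iff_le_add.1 h) with h | h
  · have := le_max_left ((wordDist s x y : ℝ) + wordDist s z w)
      ((wordDist s y z : ℝ) + wordDist s x w)
    linarith
  · have := le_max_right ((wordDist s x y : ℝ) + wordDist s z w)
      ((wordDist s y z : ℝ) + wordDist s x w)
    linarith

/-- A sequence of points with long steps and little backtracking makes linear progress. -/
lemma IsDeltaHyperbolic.chain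
    (hδ : IsDeltaHyperbolic s (δ : ℝ)) {a n : ℕ} (ha : 0 < a) (x : ℕ → G)
    (hx0 : a ≤ wordDist s (x 0) (x 1))
    (hx : ∀ i, i + 2 ≤ n → max (wordDist s (x i) (x (i + 1)))
      (wordDist s (x (i + 1)) (x (i + 2))) + 2 * δ + a ≤ wordDist s (x i) (x (i + 2))) :
    a * n ≤ wordDist s (x 0) (x n) := by
  have key : ∀ j, j + 1 ≤ n → wordDist s (x 0) (x j) + a ≤ wordDist s (x 0) (x (j + 1)) := by
    intro j
    induction j with
    | zero => intro _; rw [wordDist_self]; simpa using hx0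
    | succ j ih =>
      intro hj
      have h1 := ih (by omega)
      have h2 := hx j (by omega)
      -- By `h1` and `h2` the left side exceeds $d(x_0,x_j)+d(x_{j+1},x_{j+2})$ by at least
      -- $2\delta+2a$, so the maximum is the other sum, and that gives the gain $a$.
      have h3 := hδ.four_point (x 0) (x j) (x (j + 1)) (x (j + 2))
      simp only [show j + 1 + 1 = j + 2 from rfl] at *
      omega
  have key2 : ∀ j, j ≤ n → a * j ≤ wordDist s (x 0) (x j) := by
    intro j
    induction j with
    | zero => simp
    | succ j ih =>
      intro hj
      have h1 := ih (by omega)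
      have h2 := key j hj
      rw [mul_add, mul_one]
      omega
  exact key2 n le_rfl

lemma IsDeltaHyperbolic.localGeodesicsQuasi (hs : Subgroup.closure (Set.range s) = ⊤)
    (hδ : IsDeltaHyperbolic s (δ : ℝ)) :
    LocalGeodesicsQuasi s (8 * δ + 4) 2 ((12 * δ + 6 : ℕ) : ℝ) := by
  intro n p ⟨hp, hgeo⟩ i j hij hj
  have hup := hp.wordDist_le hij hj
  suffices h : j - i ≤ 2 * wordDist s (p i) (p j) + (12 * δ + 6) by
    refine ⟨by exact_mod_cast h, ?_⟩
    have h1 : (wordDist s (p i) (p j) : ℝ) ≤ ((j - i : ℕ) : ℝ) := by exact_mod_cast hup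
    have h2 : (0 : ℝ) ≤ ((j - i : ℕ) : ℝ) := Nat.cast_nonneg _
    have h3 : (0 : ℝ) ≤ ((12 * δ + 6 : ℕ) : ℝ) := Nat.cast_nonneg _
    linarith
  -- Two blocks of length $L$ have total length $8\delta+4$, so their union is still geodesic. As
  -- $2L=L+2\delta+(2\delta+2)$, the chain gains $2\delta+2=(L+2)/2$ per block, whence the factor
  -- $2$.
  obtain ⟨L, hL⟩ : ∃ L, L = 4 * δ + 2 := ⟨_, rfl⟩
  obtain ⟨q, hq⟩ : ∃ q, q = (j - i) / L := ⟨_, rfl⟩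
  obtain ⟨r, hr⟩ : ∃ r, r = (j - i) % L := ⟨_, rfl⟩
  have hrL : r < L := hr ▸ Nat.mod_lt _ (by omega)
  have hdiv : L * q + r = j - i := by rw [hq, hr]; exact Nat.div_add_mod _ _
  rcases Nat.eq_zero_or_pos q with h0 | hqpos
  · rw [h0] at hdiv
    omega
  have hle : ∀ t, t ≤ q → i + L * t ≤ n := fun t ht => by
    have := Nat.mul_le_mul_left L ht
    omega
  have hchain := hδ.chain (a := 2 * δ + 2) (n := q) (by omega) (fun t => p (i + L * t))
    (by
      have h1 : i + L * 1 ≤ n := hle 1 hqpos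
      have := hgeo (i + L * 0) (i + L * 1) (by omega) h1 (by omega)
      simp only [this]
      omega)
    (by
      intro t ht
      have e1 : L * (t + 1) = L * t + L := by ring
      have e2 : L * (t + 2) = L * t + L + L := by ring
      have h2 := hle (t + 2) ht
      simp only [e1, e2] at *
      rw [hgeo (i + L * t) (i + (L * t + L)) (by omega) (by omega) (by omega),
        hgeo (i + (L * t + L)) (i + (L * t + L + L)) (by omega) (by omega) (by omega),
        hgeo (i + L * t) (i + (L * t + L + L)) (by omega) (by omega) (by omega)]
      omega)
  have h1 := wordDist_triangle hs (p (i + L * 0)) (p j) (p (i + L * q))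
  have h2 := hp.wordDist_le (i := i + L * q) (j := j) (by omega) hj
  rw [wordDist_comm hs (p j)] at h1
  -- The incomplete last block, shorter than $L$, counts once in $j-i$ and twice in $2\,d(p_i,p_j)$;
  -- it costs at most $3L=12\delta+6$.
  have h3 : L * q + 2 * q = 2 * ((2 * δ + 2) * q) := by rw [hL]; ring
  simp only [mul_zero, add_zero] at h1 hchain
  omega

/-- An isometry that moves the end points of a long geodesic a little and an interior point
a lot translates along the geodesic. -/
lemma IsDeltaHyperbolic.translation (hs : Subgroup.closure (Set.range s) = ⊤)
    (hδ : IsDeltaHyperbolic s (δ : ℝ)) {D : ℕ} {f o y z : G}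
    (hz : wordDist s o z + wordDist s z y = wordDist s o y)
    (ho : wordDist s o (f * o) ≤ D) (hy : wordDist s y (f * y) ≤ D)
    (hoz : 3 * D + 4 * δ < wordDist s o z) (hzy : 3 * D + 4 * δ < wordDist s z y)
    (hf : 10 * δ + 1 ≤ wordDist s z (f * z)) :
    wordDist s z (f * z) + 2 * δ + 1 ≤ wordDist s z (f * (f * z)) := by
  have inv := wordDist_mul_left (s := s)
  have comm := wordDist_comm hs
  have tri := wordDist_triangle hs
  have fp := hδ.four_point
  -- Here $e$ is the end towards which $f$ pushes $z$: up to $6\delta$, $fz$ lies between $z$ and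
  -- $e$. Put $\ell=d(z,fz)$. In `h2` one alternative yields $d(z,f^2z)\ge
  -- 2\ell-8\delta\ge\ell+2\delta+1$, because $\ell\ge10\delta+1$. The other puts $f^2z$ at most
  -- $2\delta$ closer to $e$ than $z$, which `h1` rules out since $e$ hardly moves.
  have near : ∀ e : G, wordDist s e (f * e) ≤ D → 3 * D + 4 * δ < wordDist s e z →
      wordDist s (f * z) e + wordDist s z (f * z) ≤ wordDist s z e + 6 * δ →
      wordDist s z (f * z) + 2 * δ + 1 ≤ wordDist s z (f * (f * z)) := by
    intro e he hez h
    have h1 := fp (f * z) e (f * e) (f * (f * z))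
    have h2 := fp z (f * (f * z)) e (f * z)
    have h3 := tri e (f * (f * z)) (f * (f * e))
    have h4 := tri e (f * e) (f * (f * e))
    have h5 := tri (f * e) e (f * (f * z))
    have h6 := tri (f * (f * e)) (f * e) (f * (f * z))
    have h7 := tri (f * e) (f * (f * e)) (f * (f * z))
    have h8 := tri e (f * e) (f * (f * z))
    simp only [inv, comm (f * e) e, comm z e, comm (f * z) e, comm (f * (f * z)) e,
      comm (f * z) z] at *
    omega
  -- `h1` and `h2` give $d(o,fz)+d(fz,y)\le d(o,y)+4\delta$: the image of $z$ almost lies between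
  -- the ends. `h7` decides on which side of $z$ it lies, at the cost of another $2\delta$.
  have h1 := fp (f * o) o (f * y) (f * z)
  have h2 := fp o y (f * y) (f * z)
  have h3 := tri o (f * o) (f * z)
  have h4 := tri (f * o) o (f * z)
  have h5 := tri y (f * y) (f * z)
  have h6 := tri (f * y) y (f * z)
  have h7 := fp o z y (f * z)
  have n1 := near o ho hoz
  have n2 := near y hy (by rw [comm]; exact hzy)
  simp only [inv, comm (f * o) o, comm (f * y) y, comm y z, comm (f * z) o,
    comm (f * z) y, comm z o] at *
  omega

end Hyperbolic

/-! ### The stable norm and its positivity. -/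

section StableNorm

variable {G : Type*} [Group G] {m : ℕ} {s : Fin m → G}

lemma wordLength_pow_le (hs : Subgroup.closure (Set.range s) = ⊤) (g : G) (n : ℕ) :
    wordLength s (g ^ n) ≤ n * wordLength s g := by
  induction n with
  | zero => simp [wordLength_one]
  | succ n ih =>
    have := wordLength_mul_le hs (g ^ n) g
    rw [pow_succ, add_mul, one_mul]
    omega

lemma subadditive_wordLength_pow (hs : Subgroup.closure (Set.range s) = ⊤) (g : G) :
    Subadditive fun n : ℕ => (wordLength s (g ^ n) : ℝ) := fun a b => by
  simp only [pow_add]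
  exact_mod_cast wordLength_mul_le hs (g ^ a) (g ^ b)

lemma bddBelow_wordLength_pow_div (g : G) :
    BddBelow (Set.range fun n : ℕ => (wordLength s (g ^ n) : ℝ) / n) :=
  ⟨0, by rintro _ ⟨n, rfl⟩; positivity⟩

/-- This is Fekete's lemma for the subadditive sequence $|g^n|$. -/
lemma tendsto_stableNorm (hs : Subgroup.closure (Set.range s) = ⊤) (g : G) :
    Tendsto (fun n : ℕ => (wordLength s (g ^ n) : ℝ) / n) atTop (𝓝 (stableNorm s g)) := by
  have h := (subadditive_wordLength_pow hs g).tendsto_lim (bddBelow_wordLength_pow_div g)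
  rw [stableNorm, h.limUnder_eq]
  exact h

lemma stableNorm_le_wordLength (hs : Subgroup.closure (Set.range s) = ⊤) (g : G) :
    stableNorm s g ≤ wordLength s g := by
  have h := (subadditive_wordLength_pow hs g).tendsto_lim (bddBelow_wordLength_pow_div g)
  have h1 := (subadditive_wordLength_pow hs g).lim_le_div (bddBelow_wordLength_pow_div g)
    one_ne_zero
  rw [stableNorm, h.limUnder_eq]
  simpa using h1

lemma stableNorm_nonneg (hs : Subgroup.closure (Set.range s) = ⊤) (g : G) :
    0 ≤ stableNorm s g :=
  ge_of_tendsto' (tendsto_stableNorm hs g) fun n => by positivity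

lemma stableNorm_pow (hs : Subgroup.closure (Set.range s) = ⊤) (g : G) {i : ℕ} (hi : 0 < i) :
    stableNorm s (g ^ i) = i * stableNorm s g := by
  have h := ((tendsto_stableNorm hs g).comp (tendsto_id.const_mul_atTop' hi)).const_mul (i : ℝ)
  refine tendsto_nhds_unique (tendsto_stableNorm hs (g ^ i)) (h.congr fun n => ?_)
  have hi' : (i : ℝ) ≠ 0 := by exact_mod_cast hi.ne'
  simp only [Function.comp_apply, id_eq, ← pow_mul, Nat.cast_mul]
  rw [← mul_div_assoc, mul_div_mul_left _ _ hi']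

/-- A linear lower bound for the lengths of the powers bounds the stable norm. -/
lemma le_stableNorm (hs : Subgroup.closure (Set.range s) = ⊤) (g : G) {a c : ℝ}
    (h : ∀ n : ℕ, a * n ≤ wordLength s (g ^ n) + c) : a ≤ stableNorm s g := by
  have h1 : Tendsto (fun n : ℕ => a - c / n) atTop (𝓝 (a - 0)) :=
    tendsto_const_nhds.sub (tendsto_const_div_atTop_nhds_zero_nat c)
  rw [sub_zero] at h1
  refine le_of_tendsto_of_tendsto h1 (tendsto_stableNorm hs g) ?_
  filter_upwards [eventually_gt_atTop 0] with n hn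
  have hn' : (0 : ℝ) < n := by exact_mod_cast hn
  rw [le_div_iff₀ hn', sub_mul, div_mul_cancel₀ _ hn'.ne']
  linarith [h n]

lemma stableNorm_le_of_isConj (hs : Subgroup.closure (Set.range s) = ⊤) {g h : G}
    (hgh : IsConj g h) : stableNorm s g ≤ stableNorm s h := by
  obtain ⟨x, rfl⟩ := isConj_iff.1 hgh
  have h1 : Tendsto (fun n : ℕ => (wordLength s ((x * g * x⁻¹) ^ n) : ℝ) / n +
      (2 * wordLength s x) / n) atTop (𝓝 (stableNorm s (x * g * x⁻¹) + 0)) :=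
    (tendsto_stableNorm hs _).add (tendsto_const_div_atTop_nhds_zero_nat _)
  rw [add_zero] at h1
  refine le_of_tendsto_of_tendsto' (tendsto_stableNorm hs g) h1 fun n => ?_
  rw [← add_div]
  gcongr
  have h2 := wordLength_mul_le hs (x⁻¹ * (x * g * x⁻¹) ^ n) x
  have h3 := wordLength_mul_le hs x⁻¹ ((x * g * x⁻¹) ^ n)
  rw [wordLength_inv hs] at h3
  have h4 : x⁻¹ * (x * g * x⁻¹) ^ n * x = g ^ n := by
    rw [conj_pow]
    group
  rw [h4] at h2
  have h5 : wordLength s (g ^ n) ≤ wordLength s ((x * g * x⁻¹) ^ n) + 2 * wordLength s x := by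
    omega
  exact_mod_cast h5

lemma stableNorm_eq_of_isConj (hs : Subgroup.closure (Set.range s) = ⊤) {g h : G}
    (hgh : IsConj g h) : stableNorm s g = stableNorm s h :=
  le_antisymm (stableNorm_le_of_isConj hs hgh) (stableNorm_le_of_isConj hs hgh.symm)

lemma not_isOfFinOrder_of_stableNorm_pos (hs : Subgroup.closure (Set.range s) = ⊤) {g : G}
    (hg : 0 < stableNorm s g) : ¬ IsOfFinOrder g := by
  intro h
  obtain ⟨i, hi, h1⟩ := isOfFinOrder_iff_pow_eq_one.1 h
  have h2 := stableNorm_pow hs g hi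
  have h3 := stableNorm_le_wordLength hs (1 : G)
  rw [h1] at h2
  rw [wordLength_one, h2] at h3
  have : (0 : ℝ) < i := by exact_mod_cast hi
  have := mul_pos this hg
  simp at h3
  linarith

lemma exists_long_pow (hs : Subgroup.closure (Set.range s) = ⊤) {h : G}
    (hh : ¬ IsOfFinOrder h) (r : ℕ) : ∃ n : ℕ, r < wordLength s (h ^ n) := by
  by_contra! hcon
  have hinj := injective_pow_iff_not_isOfFinOrder.2 hh
  exact (Set.infinite_range_of_injective hinj)
    ((finite_ball hs r).subset (by rintro _ ⟨n, rfl⟩; exact hcon n))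

/-- In a hyperbolic group elements of infinite order have positive stable norm. -/
lemma IsDeltaHyperbolic.stableNorm_pos {δ : ℕ} (hs : Subgroup.closure (Set.range s) = ⊤)
    (hδ : IsDeltaHyperbolic s (δ : ℝ)) {h : G} (hh : ¬ IsOfFinOrder h) :
    0 < stableNorm s h := by
  have hinj := injective_pow_iff_not_isOfFinOrder.2 hh
  -- The radius is the threshold in `IsDeltaHyperbolic.translation`. Among $P+1$ distinct powers of
  -- $h$, one must have its conjugate by $z$ outside this ball of $P$ elements; $D$ bounds the
  -- lengths of all these powers.
  have hfin := finite_ball hs (10 * δ)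
  set P := hfin.toFinset.card with hP
  set D := (P + 1) * wordLength s h with hD
  have hDle : ∀ i ≤ P + 1, wordLength s (h ^ i) ≤ D := fun i hi =>
    (wordLength_pow_le hs h i).trans (Nat.mul_le_mul_right _ hi)
  obtain ⟨M, hM⟩ : ∃ M, M = 3 * D + 4 * δ + 1 := ⟨_, rfl⟩
  obtain ⟨n, hn⟩ := exists_long_pow hs hh (2 * M)
  obtain ⟨w, hw, hwe⟩ := exists_geodesic_word hs (h ^ n)
  obtain ⟨z, hz⟩ : ∃ z, z = wordEval s (w.take M) := ⟨_, rfl⟩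
  have hgeo := geodesic_of_append hs (s := s) (v := w.take M) (w := w.drop M)
    (by rw [List.take_append_drop, hw, hwe])
  have hzy : z⁻¹ * h ^ n = wordEval s (w.drop M) := by
    rw [← hwe, hz, ← List.take_append_drop M w, wordEval_append]
    simp
  have h1 : wordDist s 1 z = M := by
    rw [wordDist_one_left, hz, hgeo.1, List.length_take]
    omega
  have h2 : wordDist s z (h ^ n) = w.length - M := by
    rw [wordDist, hzy, hgeo.2, List.length_drop]
  have h3 : wordDist s 1 (h ^ n) = w.length := by rw [wordDist_one_left, hw]
  -- a power moving `z` far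
  obtain ⟨i, hi0, hiP, hi⟩ : ∃ i, 0 < i ∧ i ≤ P + 1 ∧ 10 * δ + 1 ≤ wordDist s z (h ^ i * z) := by
    by_contra! hcon
    have hmaps : ∀ i ∈ Finset.range (P + 1), z⁻¹ * (h ^ (i + 1) * z) ∈ hfin.toFinset := by
      intro i hi
      rw [Finset.mem_range] at hi
      have := hcon (i + 1) (by omega) (by omega)
      rw [wordDist] at this
      simp only [Set.Finite.mem_toFinset, Set.mem_ofPred_eq]
      omega
    have hcard := Finset.card_le_card_of_injOn _ hmaps (by
      intro i _ j _ hij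
      have := hinj (mul_right_cancel (mul_left_cancel hij))
      omega)
    rw [Finset.card_range] at hcard
    omega
  set f := h ^ i with hf
  -- As $f$ commutes with $h^n$, it moves both ends $1$ and $h^n$ by $|f|\le D$, however large $n$
  -- is.
  have hcomm : (h ^ n)⁻¹ * (f * h ^ n) = f := by
    rw [hf, ← pow_add, add_comm, pow_add, inv_mul_cancel_left]
  have htrans := hδ.translation hs (D := D) (f := f) (o := 1) (y := h ^ n) (z := z)
    (by omega) (by rw [wordDist_one_left, mul_one]; exact hDle i hiP)
    (by rw [wordDist, hcomm]; exact hDle i hiP) (by omega) (by omega) hi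
  have hchain : ∀ t : ℕ, t ≤ wordDist s z (f ^ t * z) := by
    intro t
    have := hδ.chain (a := 1) (n := t) one_pos (fun t => f ^ t * z)
      (by simp only [pow_zero, one_mul, pow_one]; omega)
      (by
        intro j _
        simp only [pow_succ (f) (j + 1), pow_succ f j, mul_assoc, wordDist_mul_left,
          show j + 2 = (j + 1) + 1 from rfl]
        simp only [← mul_assoc] at *
        simpa using htrans)
    simpa using this
  have hpos : 1 ≤ stableNorm s f := le_stableNorm hs f (c := 2 * wordLength s z) fun t => by
    have h4 := hchain t
    have h5 := wordLength_mul_le hs z⁻¹ (f ^ t * z)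
    have h6 := wordLength_mul_le hs (f ^ t) z
    rw [wordLength_inv hs] at h5
    rw [wordDist] at h4
    have h7 : t ≤ wordLength s (f ^ t) + 2 * wordLength s z := by omega
    rw [one_mul]
    exact_mod_cast h7
  rw [hf, stableNorm_pow hs h hi0] at hpos
  by_contra! hcon
  nlinarith [(Nat.cast_pos (α := ℝ)).2 hi0]

end StableNorm

/-! ### Cyclically reduced words. -/

section CyclicReduction

variable {G : Type*} [Group G] {m : ℕ} {s : Fin m → G}

lemma wordEval_map_range_add (a : ℕ → Fin m × Bool) (i t : ℕ) :
    wordEval s ((List.range (i + t)).map a) = wordEval s ((List.range i).map a) *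
      wordEval s ((List.range t).map fun j => a (i + j)) := by
  rw [List.range_add, List.map_append, wordEval_append, List.map_map]
  rfl

/-- Powers of a long cyclically reduced word label local geodesics. -/
lemma IsCyclicallyReduced.isLocalGeodesic (hs : Subgroup.closure (Set.range s) = ⊤)
    {w : Word m} (hw : IsCyclicallyReduced s w) {k : ℕ} (hk : 0 < k) (hkw : k ≤ w.length)
    (n : ℕ) : ∃ p : ℕ → G, IsLocalGeodesic s k n p ∧
      ∀ t, p (t * w.length) = wordEval s w ^ t := by
  have hpos : 0 < w.length := by omega
  set a : ℕ → Fin m × Bool := fun j => w[j % w.length]'(Nat.mod_lt _ hpos) with ha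
  -- A window of length at most $|w|$ in the periodic word $www\cdots$ is a prefix of a rotation of
  -- $w$, hence geodesic.
  have hrot : ∀ i t, t ≤ w.length →
      (List.range t).map (fun j => a (i + j)) = (w.rotate i).take t := by
    intro i t ht
    refine List.ext_getElem (by simp [ht]) fun j h1 h2 => ?_
    simp [ha, List.getElem_rotate, add_comm]
  refine ⟨fun j => wordEval s ((List.range j).map a), ⟨fun i _ => ⟨a i, ?_⟩, ?_⟩, ?_⟩
  · simp only [wordEval_map_range_add]
    simp [List.range_one]
  · intro i j hij _ hjk
    obtain ⟨t, rfl⟩ := Nat.exists_eq_add_of_le hij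
    simp only [add_tsub_cancel_left] at hjk ⊢
    rw [wordDist, wordEval_map_range_add, inv_mul_cancel_left, hrot i t (by omega)]
    have h1 := geodesic_of_append hs (s := s) (v := (w.rotate i).take t)
      (w := (w.rotate i).drop t) (by
        rw [List.take_append_drop]
        exact hw _ ⟨i, rfl⟩)
    rw [h1.1, List.length_take, List.length_rotate]
    omega
  · intro t
    induction t with
    | zero => simp
    | succ t ih =>
      simp only [add_mul, one_mul, wordEval_map_range_add] at ih ⊢
      rw [ih, hrot _ _ le_rfl, pow_succ]
      congr 2
      rw [mul_comm, List.rotate_length_mul, List.take_length]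

/-- The quasigeodesic inequality for the path labelled $w^n$ reads
$n|w|\le\lambda\,|g^n|+\varepsilon$, where $g$ is the element represented by $w$. -/
lemma IsCyclicallyReduced.length_div_le_stableNorm (hs : Subgroup.closure (Set.range s) = ⊤)
    {w : Word m} (hw : IsCyclicallyReduced s w) {k : ℕ} (hk : 0 < k) (hkw : k ≤ w.length)
    {lam eps : ℝ} (hlam : 1 ≤ lam) (hq : LocalGeodesicsQuasi s k lam eps) :
    w.length / lam ≤ stableNorm s (wordEval s w) := by
  have h0 : 0 < lam := by linarith
  refine le_stableNorm hs _ (c := eps / lam) fun n => ?_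
  obtain ⟨p, hp, hpt⟩ := hw.isLocalGeodesic hs hk hkw (n * w.length)
  have h1 := (hq _ p hp 0 (n * w.length) (Nat.zero_le _) le_rfl).1
  have h2 : p 0 = 1 := by simpa using hpt 0
  rw [hpt, h2, wordDist_one_left, Nat.sub_zero, Nat.cast_mul] at h1
  rw [div_mul_eq_mul_div, div_le_iff₀ h0, add_mul, div_mul_cancel₀ _ h0.ne']
  linarith

lemma IsCyclicReduction.length_eq_zero_iff
    {ρ : G → Word m} (hρ : IsCyclicReduction s ρ) (g : G) :
    (ρ g).length = 0 ↔ g = 1 := by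
  constructor
  · intro h
    have := (hρ g).2
    rw [List.length_eq_zero_iff.1 h, wordEval_nil] at this
    exact isConj_one_left.1 this
  · rintro rfl
    rw [← (hρ 1).1 _ (List.IsRotated.refl _), isConj_one_right.1 (hρ 1).2, wordLength_one]

/-- A shortest word among those representing conjugates of $g$ works: its rotations represent
conjugates too, so none can be shortened. -/
lemma exists_isCyclicReduction (hs : Subgroup.closure (Set.range s) = ⊤) :
    ∃ ρ : G → Word m, IsCyclicReduction s ρ := by
  suffices h : ∀ g : G, ∃ w : Word m, IsCyclicallyReduced s w ∧ IsConj g (wordEval s w) by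
    choose ρ hρ using h
    exact ⟨ρ, hρ⟩
  intro g
  have hex : ∃ n, ∃ w : Word m, w.length = n ∧ IsConj g (wordEval s w) := by
    obtain ⟨w, hw⟩ := exists_wordEval_eq hs g
    exact ⟨w.length, w, rfl, hw ▸ IsConj.refl _⟩
  classical
  obtain ⟨w, hw, hconj⟩ := Nat.find_spec hex
  refine ⟨w, fun w' hw' => ?_, hconj⟩
  have hconj' : IsConj g (wordEval s w') := by
    obtain ⟨i, rfl⟩ := hw'
    rw [List.rotate_eq_drop_append_take_mod, wordEval_append]
    refine hconj.trans (isConj_iff.2 ⟨(wordEval s (w.take (i % w.length)))⁻¹, ?_⟩)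
    conv_lhs => rw [← List.take_append_drop (i % w.length) w, wordEval_append]
    simp
  obtain ⟨v, hv, hve⟩ := exists_geodesic_word hs (wordEval s w')
  refine le_antisymm (wordLength_wordEval_le w') ?_
  rw [← hw'.perm.length_eq, hw, ← hv]
  exact Nat.find_le ⟨v, rfl, hve ▸ hconj'⟩

end CyclicReduction

/-! ### The search and the bound by $n_{\max}$. -/

section Search

variable {G : Type*} [Group G] {m : ℕ} {s : Fin m → G}

lemma SearchReturns.unique {k : ℕ} {ρ : G → Word m} {g : G} {n n' : ℕ}
    (h : SearchReturns k ρ g n) (h' : SearchReturns k ρ g n') : n = n' := by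
  rcases lt_trichotomy n n' with hlt | rfl | hlt
  · exact absurd (Or.inl h.2.1) (h'.2.2 n h.1 hlt)
  · rfl
  · exact absurd (Or.inl h'.2.1) (h.2.2 n' h'.1 hlt)

variable {δ : ℕ} {k : ℕ} {lam eps : ℝ} {ρ : G → Word m}

/-- The reduced words get arbitrarily long, since $|\rho(g^n)|\ge[[g^n]]=n[[g]]$ and $[[g]]>0$; none
is empty along the way. -/
lemma IsDeltaHyperbolic.exists_searchReturns (hs : Subgroup.closure (Set.range s) = ⊤)
    (hδ : IsDeltaHyperbolic s (δ : ℝ)) (hρ : IsCyclicReduction s ρ) {g : G}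
    (hg : ¬ IsOfFinOrder g) (k : ℕ) : ∃ n, SearchReturns k ρ g n := by
  classical
  have hpos := hδ.stableNorm_pos hs hg
  obtain ⟨N, hN⟩ := exists_nat_gt (k / stableNorm s g)
  have hex : ∃ n, 2 ≤ n ∧ k ≤ (ρ (g ^ n)).length := by
    refine ⟨N + 2, by omega, ?_⟩
    have h1 := stableNorm_pow hs g (i := N + 2) (by omega)
    rw [stableNorm_eq_of_isConj hs (hρ (g ^ (N + 2))).2] at h1
    have h2 := stableNorm_le_wordLength hs (wordEval s (ρ (g ^ (N + 2))))
    rw [h1, (hρ _).1 _ (List.IsRotated.refl _)] at h2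
    rw [div_lt_iff₀ hpos] at hN
    push_cast at h2
    have h3 : (k : ℝ) ≤ (ρ (g ^ (N + 2))).length := by nlinarith
    exact_mod_cast h3
  refine ⟨Nat.find hex, (Nat.find_spec hex).1, (Nat.find_spec hex).2, fun i h2 hi => ?_⟩
  rintro (h | h)
  · exact Nat.find_min hex hi ⟨h2, h⟩
  · rw [hρ.length_eq_zero_iff] at h
    exact hg (isOfFinOrder_iff_pow_eq_one.2 ⟨i, by omega, h⟩)

lemma SearchReturns.not_isOfFinOrder (hs : Subgroup.closure (Set.range s) = ⊤)
    (hρ : IsCyclicReduction s ρ) (hk : 0 < k) (hlam : 1 ≤ lam)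
    (hq : LocalGeodesicsQuasi s k lam eps) {g : G} {n : ℕ} (h : SearchReturns k ρ g n) :
    ¬ IsOfFinOrder g := by
  have h1 := (hρ (g ^ n)).1.length_div_le_stableNorm hs hk h.2.1 hlam hq
  rw [← stableNorm_eq_of_isConj hs (hρ (g ^ n)).2] at h1
  have h2 : (0 : ℝ) < (ρ (g ^ n)).length := by exact_mod_cast hk.trans_le h.2.1
  exact fun hg => not_isOfFinOrder_of_stableNorm_pos hs
    ((div_pos h2 (by linarith)).trans_le h1) hg.pow

lemma IsDeltaHyperbolic.exists_searchStopsAt (hs : Subgroup.closure (Set.range s) = ⊤)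
    (hδ : IsDeltaHyperbolic s (δ : ℝ)) (hρ : IsCyclicReduction s ρ) (k : ℕ) (g : G) :
    ∃ i, 2 ≤ i ∧ SearchStopsAt k ρ g i := by
  by_cases hg : IsOfFinOrder g
  · obtain ⟨i, hi, h1⟩ := isOfFinOrder_iff_pow_eq_one.1 hg
    -- The exponent is doubled because the search starts at $2$ and $i$ may be $1$.
    refine ⟨2 * i, by omega, Or.inr ?_⟩
    rw [hρ.length_eq_zero_iff, mul_comm, pow_mul, h1, one_pow]
  · obtain ⟨n, h⟩ := hδ.exists_searchReturns hs hρ hg k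
    exact ⟨n, h.1, Or.inl h.2.1⟩

lemma exists_isNMax (hs : Subgroup.closure (Set.range s) = ⊤) (k : ℕ) (ρ : G → Word m) :
    ∃ N, IsNMax s k ρ N := by
  have hfin : ({1} ∪ {n : ℕ | ∃ g : G, wordLength s g ≤ k - 1 ∧ SearchReturns k ρ g n}).Finite := by
    refine (Set.finite_singleton 1).union ?_
    have : {n : ℕ | ∃ g : G, wordLength s g ≤ k - 1 ∧ SearchReturns k ρ g n} =
        ⋃ g ∈ {g : G | wordLength s g ≤ k - 1}, {n | SearchReturns k ρ g n} := by
      ext n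
      simp
    rw [this]
    exact (finite_ball hs (k - 1)).biUnion fun g _ =>
      Set.Subsingleton.finite fun n hn n' hn' => SearchReturns.unique hn hn'
  obtain ⟨N, hN, hmax⟩ := Set.exists_max_image _ id hfin ⟨1, Or.inl rfl⟩
  exact ⟨N, hN, hmax⟩

lemma IsNMax.pos {N : ℕ} (hN : IsNMax s k ρ N) : 0 < N := hN.2 (Or.inl rfl)

lemma IsDeltaHyperbolic.div_le_stableNorm (hs : Subgroup.closure (Set.range s) = ⊤)
    (hδ : IsDeltaHyperbolic s (δ : ℝ)) (hρ : IsCyclicReduction s ρ) (hk : 0 < k)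
    (hlam : 1 ≤ lam) (hq : LocalGeodesicsQuasi s k lam eps) {N : ℕ} (hN : IsNMax s k ρ N)
    {g : G} (hg : ¬ IsOfFinOrder g) : (k : ℝ) / (lam * N) ≤ stableNorm s g := by
  have hlam0 : 0 < lam := by linarith
  have hN0 : (0 : ℝ) < N := by exact_mod_cast hN.pos
  have key : ∀ h : G, k ≤ (ρ h).length → k / lam ≤ stableNorm s h := fun h hh => by
    have h1 := (hρ h).1.length_div_le_stableNorm hs hk hh hlam hq
    rw [← stableNorm_eq_of_isConj hs (hρ h).2] at h1
    refine le_trans ?_ h1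
    gcongr
  rw [← div_div, div_le_iff₀ hN0]
  by_cases hlen : k ≤ (ρ g).length
  · refine (key g hlen).trans (le_mul_of_one_le_right (stableNorm_nonneg hs g) ?_)
    exact_mod_cast hN.pos
  · have hconj := (hρ g).2
    obtain ⟨h, hh⟩ : ∃ h, h = wordEval s (ρ g) := ⟨_, rfl⟩
    rw [← hh] at hconj
    have hle : wordLength s h ≤ k - 1 := by
      have := wordLength_wordEval_le (s := s) (ρ g)
      rw [← hh] at this
      omega
    have hpos := hδ.stableNorm_pos hs hg
    rw [stableNorm_eq_of_isConj hs hconj] at hpos ⊢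
    obtain ⟨n, hn⟩ := hδ.exists_searchReturns hs hρ
      (not_isOfFinOrder_of_stableNorm_pos hs hpos) k
    have hnN : n ≤ N := hN.2 (Or.inr ⟨h, hle, hn⟩)
    have h1 := key _ hn.2.1
    rw [stableNorm_pow hs h (by have := hn.1; omega)] at h1
    have h2 : (n : ℝ) ≤ N := by exact_mod_cast hnN
    nlinarith

end Search

/-! ### Solving the word problem by rewriting to local geodesics. -/

section WordProblem

variable {G : Type*} [Group G] {m : ℕ} {s : Fin m → G}

/-- One pass of a rewriting system from right to left: `T` rewrites words of length at most `k`. -/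
def rewritePass {α : Type*} (T : List α → List α) (k : ℕ) (w : List α) : List α :=
  w.foldr (fun a acc => T ((a :: acc).take k) ++ (a :: acc).drop k) []

lemma rewritePass_cons {α : Type*} (T : List α → List α) (k : ℕ) (a : α) (w : List α) :
    rewritePass T k (a :: w) =
      T ((a :: rewritePass T k w).take k) ++ (a :: rewritePass T k w).drop k := rfl

lemma primrec_rewritePass {α : Type*} [Primcodable α] {T : List α → List α} (hT : Primrec T)
    (k : ℕ) : Primrec (rewritePass T k) := by
  have hc : Primrec fun x : List α × (α × List α) => x.2.1 :: x.2.2 :=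
    Primrec.list_cons.comp (Primrec.fst.comp Primrec.snd) (Primrec.snd.comp Primrec.snd)
  exact Primrec.list_foldr Primrec.id (Primrec.const [])
    (Primrec.list_append.comp (hT.comp (Primrec.list_take.comp (Primrec.const k) hc))
      (Primrec.list_drop.comp (Primrec.const k) hc)).to₂

/-- A finite table is a nested case distinction. Its entries are merely known to exist, which
suffices for a program that may depend on $G$. -/
lemma exists_primrec_eqOn {α β : Type*} [Primcodable α] [Primcodable β] [Inhabited β]
    {S : Set α} (hS : S.Finite) (T : α → β) : ∃ f : α → β, Primrec f ∧ Set.EqOn f T S := by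
  classical
  induction S, hS using Set.Finite.induction_on with
  | empty => exact ⟨fun _ => default, Primrec.const _, by simp⟩
  | @insert a S _ _ ih =>
    obtain ⟨f, hf, h⟩ := ih
    refine ⟨fun x => if x = a then T a else f x,
      Primrec.ite (Primrec.eq.comp Primrec.id (Primrec.const a)) (Primrec.const _) hf, ?_⟩
    rintro x (rfl | hx)
    · simp
    · by_cases hxa : x = a
      · simp [hxa]
      · simpa [hxa] using h hx

lemma encode_map_val (w : Word m) :
    Encodable.encode (w.map fun a => ((a.1 : ℕ), a.2)) = Encodable.encode w := by
  induction w with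
  | nil => rfl
  | cons a w ih =>
    rw [List.map_cons, Encodable.encode_list_cons, Encodable.encode_list_cons, ih]
    rfl

variable {T : Word m → Word m} {k : ℕ}

/-- `T` replaces each word of length at most `k` by a geodesic word for the same element. -/
def ShortensUpTo (s : Fin m → G) (T : Word m → Word m) (k : ℕ) : Prop :=
  ∀ u : Word m, u.length ≤ k → wordEval s (T u) = wordEval s u ∧
    (T u).length = wordLength s (wordEval s u) ∧ ((T u).length = u.length → T u = u)

/-- No replacement lengthens a word, so a pass that preserves the total length made no change at any
position; then every window of length at most $k$ was already geodesic. -/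
lemma ShortensUpTo.rewritePass (hT : ShortensUpTo s T k) (w : Word m) :
    wordEval s (rewritePass T k w) = wordEval s w ∧ (rewritePass T k w).length ≤ w.length ∧
    ((rewritePass T k w).length = w.length → rewritePass T k w = w ∧
      ∀ i, wordLength s (wordEval s ((w.drop i).take k)) = ((w.drop i).take k).length) := by
  induction w with
  | nil => simp [WordHyp.rewritePass, wordLength_one]
  | cons a w ih =>
    obtain ⟨h1, h2, h3⟩ := ih
    rw [rewritePass_cons]
    obtain ⟨v, hv⟩ : ∃ v, v = a :: WordHyp.rewritePass T k w := ⟨_, rfl⟩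
    rw [← hv]
    have hvl : v.length = (WordHyp.rewritePass T k w).length + 1 := by rw [hv, List.length_cons]
    obtain ⟨e1, e2, e3⟩ := hT (v.take k) (by simp)
    have e4 := wordLength_wordEval_le (s := s) (v.take k)
    rw [← e2] at e4
    have hsplit : (v.take k).length + (v.drop k).length = v.length := by
      rw [← List.length_append, List.take_append_drop]
    refine ⟨?_, ?_, fun h => ?_⟩
    · rw [wordEval_append, e1, ← wordEval_append, List.take_append_drop, hv, wordEval_cons, h1,
        wordEval_cons]
    · rw [List.length_append, List.length_cons]
      omega
    · rw [List.length_append, List.length_cons] at h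
      obtain ⟨h4, h5⟩ := h3 (by omega)
      have h6 := e3 (by omega)
      rw [h4] at hv
      refine ⟨by rw [h6, List.take_append_drop, hv], fun i => ?_⟩
      cases i with
      | zero => rw [List.drop_zero, ← hv, ← e2, h6]
      | succ i => simpa using h5 i

lemma isLocalGeodesic_of_drop_take (hs : Subgroup.closure (Set.range s) = ⊤) {w : Word m}
    (hw : ∀ i, wordLength s (wordEval s ((w.drop i).take k)) = ((w.drop i).take k).length) :
    IsLocalGeodesic s k w.length fun j => wordEval s (w.take j) := by
  refine ⟨fun i hi => ⟨w[i], ?_⟩, fun i j hij hj hjk => ?_⟩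
  · simp only [List.take_succ_eq_append_getElem hi, wordEval_append]
    simp
  · have h1 : w.take j = w.take i ++ (w.drop i).take (j - i) := by
      rw [← List.take_add, Nat.add_sub_cancel' hij]
    have h2 : ((w.drop i).take k).take (j - i) = (w.drop i).take (j - i) := by
      rw [List.take_take, min_eq_left hjk]
    have h3 := geodesic_of_append hs (s := s) (v := ((w.drop i).take k).take (j - i))
      (w := ((w.drop i).take k).drop (j - i)) (by rw [List.take_append_drop]; exact hw i)
    rw [h2] at h3
    simp only [h1]
    rw [wordDist, wordEval_append, inv_mul_cancel_left, h3.1, List.length_take, List.length_drop]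
    omega

/-- Each pass shortens the word or has reached a fixed point, so $|w|$ passes suffice. -/
lemma ShortensUpTo.iterate (hT : ShortensUpTo s T k) (w : Word m) (n : ℕ) :
    wordEval s ((WordHyp.rewritePass T k)^[n] w) = wordEval s w ∧
    (((WordHyp.rewritePass T k)^[n] w).length + n ≤ w.length ∨
      WordHyp.rewritePass T k ((WordHyp.rewritePass T k)^[n] w) =
        (WordHyp.rewritePass T k)^[n] w) := by
  induction n with
  | zero => simp
  | succ n ih =>
    obtain ⟨h1, h2⟩ := ih
    rw [Function.iterate_succ_apply']
    obtain ⟨h3, h4, h5⟩ := hT.rewritePass ((WordHyp.rewritePass T k)^[n] w)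
    refine ⟨h3.trans h1, ?_⟩
    rcases h2 with h2 | h2
    · by_cases h : (WordHyp.rewritePass T k ((WordHyp.rewritePass T k)^[n] w)).length =
          ((WordHyp.rewritePass T k)^[n] w).length
      · right
        rw [(h5 h).1, (h5 h).1]
      · left
        omega
    · right
      rw [h2, h2]

/-- A fixed point labels a $k$-local geodesic; if it is closed, its ends have distance $0$ and its
length is at most $\varepsilon$. -/
lemma ShortensUpTo.length_iterate_le (hs : Subgroup.closure (Set.range s) = ⊤)
    (hT : ShortensUpTo s T k) {lam : ℝ} {eps : ℕ} (hq : LocalGeodesicsQuasi s k lam eps)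
    {w : Word m} (hw : wordEval s w = 1) :
    ((WordHyp.rewritePass T k)^[w.length] w).length ≤ eps := by
  obtain ⟨h1, h2 | h2⟩ := hT.iterate w w.length
  · omega
  · obtain ⟨v, hv⟩ : ∃ v, v = (WordHyp.rewritePass T k)^[w.length] w := ⟨_, rfl⟩
    rw [← hv] at h1 h2 ⊢
    have h3 := isLocalGeodesic_of_drop_take hs ((hT.rewritePass v).2.2 (by rw [h2])).2
    have h4 := (hq _ _ h3 0 v.length (Nat.zero_le _) le_rfl).1
    simp only [List.take_zero, List.take_length, h1, hw, wordEval_nil, wordDist_self] at h4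
    simpa using h4

lemma exists_solvesWordProblem (hs : Subgroup.closure (Set.range s) = ⊤) {lam : ℝ} {eps : ℕ}
    (hq : LocalGeodesicsQuasi s k lam eps) :
    ∃ c : Nat.Partrec.Code, SolvesWordProblem s c := by
  classical
  have hgeo : ∀ u : Word m, ∃ v : Word m, wordEval s v = wordEval s u ∧
      v.length = wordLength s (wordEval s u) ∧ (v.length = u.length → v = u) := fun u => by
    by_cases hu : wordLength s (wordEval s u) = u.length
    · exact ⟨u, rfl, hu.symm, fun _ => rfl⟩
    · obtain ⟨v, hv, hve⟩ := exists_geodesic_word hs (wordEval s u)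
      exact ⟨v, hve, hv, fun h => absurd (hv.symm.trans h) hu⟩
  choose T₀ hT₀ using hgeo
  obtain ⟨T, hTp, hTe⟩ := exists_primrec_eqOn (List.finite_length_le (Fin m × Bool) k) T₀
  have hT : ShortensUpTo s T k := fun u hu => by
    rw [hTe (show u ∈ {l : Word m | l.length ≤ k} from hu)]
    exact hT₀ u
  obtain ⟨b, hbp, hbe⟩ := exists_primrec_eqOn (List.finite_length_le (Fin m × Bool) eps)
    (fun u : Word m => if wordEval s u = 1 then 1 else 0)
  have hred : Primrec fun w : Word m => (rewritePass T k)^[w.length] w :=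
    Primrec.nat_iterate Primrec.list_length Primrec.id
      ((primrec_rewritePass hTp k).comp Primrec.snd).to₂
  have hans : Primrec fun w : Word m =>
      if ((rewritePass T k)^[w.length] w).length ≤ eps then
        b ((rewritePass T k)^[w.length] w) else 0 :=
    Primrec.ite (Primrec.nat_le.comp (Primrec.list_length.comp hred) (Primrec.const eps))
      (hbp.comp hred) (Primrec.const 0)
  obtain ⟨c, hc⟩ := Nat.Partrec.Code.exists_code.1 hans.to_comp.partrec
  have heval : ∀ w : Word m, c.eval (Encodable.encode (w.map fun a => ((a.1 : ℕ), a.2))) =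
      Part.some (if ((rewritePass T k)^[w.length] w).length ≤ eps then
        b ((rewritePass T k)^[w.length] w) else 0) := fun w => by
    rw [encode_map_val, hc]
    simp
  refine ⟨c, fun w => ⟨fun hw => ?_, fun hw => ?_⟩⟩ <;>
    rw [heval, Part.mem_some_iff]
  · have h1 := hT.length_iterate_le hs hq hw
    rw [if_pos h1, hbe (show _ ∈ {l : Word m | l.length ≤ eps} from h1)]
    simp [(hT.iterate w w.length).1, hw]
  · split_ifs with h1
    · rw [hbe (show _ ∈ {l : Word m | l.length ≤ eps} from h1)]
      simp [(hT.iterate w w.length).1, hw]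
    · rfl

end WordProblem

/-! ### Primitive recursive predicates with quantifiers over lists. -/

section PrimrecPred

variable {X γ : Type*} [Primcodable X] [Primcodable γ]

lemma primrecPred_forall_mem {L : X → List γ} {p : X → γ → Prop} (hL : Primrec L)
    (hp : PrimrecPred fun z : X × γ => p z.1 z.2) : PrimrecPred fun x => ∀ y ∈ L x, p x y := by
  have h : PrimrecRel fun (y : γ) (x : X) => p x y := (hp.comp (Primrec.snd.pair Primrec.fst))
  exact (PrimrecRel.forall_mem_list h).comp hL Primrec.id

lemma primrecPred_exists_mem {L : X → List γ} {p : X → γ → Prop} (hL : Primrec L)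
    (hp : PrimrecPred fun z : X × γ => p z.1 z.2) : PrimrecPred fun x => ∃ y ∈ L x, p x y := by
  have h : PrimrecRel fun (y : γ) (x : X) => p x y := (hp.comp (Primrec.snd.pair Primrec.fst))
  exact (PrimrecRel.exists_mem_list h).comp hL Primrec.id

lemma primrecPred_imp {p q : X → Prop} (hp : PrimrecPred p) (hq : PrimrecPred q) :
    PrimrecPred fun x => p x → q x :=
  (hp.not.or hq).of_eq fun _ => imp_iff_not_or.symm

lemma primrecPred_mem {L : X → List γ} {f : X → γ} (hf : Primrec f) (hL : Primrec L) :
    PrimrecPred fun x => f x ∈ L x :=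
  (primrecPred_exists_mem (p := fun x y => y = f x) hL
    (Primrec.eq.comp Primrec.snd (hf.comp Primrec.fst))).of_eq fun x => by simp

end PrimrecPred

/-! ### Certificates for $n_{\max}$ and their primitive recursive checking. -/

section Certificates

open Nat.Partrec (Code)

/-- Words on numbered letters. -/
abbrev RawWord := List (ℕ × Bool)

/-- The numbered letters of a word. -/
def rawWord {m : ℕ} (w : Word m) : RawWord := w.map fun a => ((a.1 : ℕ), a.2)

/-- The `n`-th power of a word. -/
def wordPow {α : Type*} (w : List α) (n : ℕ) : List α := (List.range n).flatMap fun _ => w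

/-- The program halts on `w` with output `1` within the given time. -/
def CertTrivial (E : ℕ × Code) (w : RawWord) : Prop :=
  Code.evaln E.1 E.2 (Encodable.encode w) = some 1

/-- The program halts on `w` with output `0` within the given time. -/
def CertNontrivial (E : ℕ × Code) (w : RawWord) : Prop :=
  Code.evaln E.1 E.2 (Encodable.encode w) = some 0

/-- `A` consists of words on `m` letters and is seen to contain all those of length `≤ B`. -/
def CertWords (m B : ℕ) (A : List RawWord) : Prop :=
  [] ∈ A ∧ ∀ w ∈ A, (∀ a ∈ w, a.1 < m) ∧
    (B ≤ w.length ∨ ∀ i ∈ List.range m, (i, true) :: w ∈ A ∧ (i, false) :: w ∈ A)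

/-- The program shows that `v` is cyclically reduced. -/
def CertReduced (E : ℕ × Code) (A : List RawWord) (v : RawWord) : Prop :=
  ∀ p ∈ A, ∀ q ∈ A, p ++ q = v → ∀ z ∈ A, z.length < v.length →
    CertNontrivial E (wordInv z ++ (q ++ p))

/-- The entry `(e, v, x)` shows that `v` is a cyclically reduced word with `e = x v x⁻¹`. -/
def CertEntry (E : ℕ × Code) (m B : ℕ) (A : List RawWord) (t : RawWord × RawWord × RawWord) :
    Prop :=
  (∀ a ∈ t.1, a.1 < m) ∧ t.2.1 ∈ A ∧ t.2.2 ∈ A ∧ t.2.1.length ≤ B ∧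
    CertTrivial E (t.1 ++ wordInv (t.2.2 ++ t.2.1 ++ wordInv t.2.2)) ∧ CertReduced E A t.2.1

/-- The table `T` of cyclic reductions shows that the search at `u` returns `n`. -/
def CertReturns (κ : ℕ) (T : List (RawWord × RawWord × RawWord)) (u : RawWord) (n : ℕ) : Prop :=
  2 ≤ n ∧ (∃ t ∈ T, t.1 = wordPow u n ∧ κ ≤ t.2.1.length) ∧
    ∀ i ∈ List.range n, 2 ≤ i → ∃ t ∈ T, t.1 = wordPow u i ∧ t.2.1.length < κ ∧ 0 < t.2.1.length

/-- A certificate for `N` being `n_max` for a cyclic reduction that extends the table `T`. -/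
def CertNMax (E : ℕ × Code) (m κ N B : ℕ) (A : List RawWord)
    (T : List (RawWord × RawWord × RawWord)) : Prop :=
  κ ≤ B ∧ CertWords m B A ∧ (∀ t ∈ T, CertEntry E m B A t) ∧
    (∀ t ∈ T, ∀ t' ∈ T, t.2.1 = t'.2.1 ∨ CertNontrivial E (t.1 ++ wordInv t'.1)) ∧
    (∀ u ∈ A, u.length < κ → (∃ n ∈ List.range (N + 1), CertReturns κ T u n) ∨
      ∃ n ∈ List.range E.1, CertTrivial E (wordPow u (n + 1))) ∧
    (N = 1 ∨ ∃ u ∈ A, u.length < κ ∧ CertReturns κ T u N)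

section Primrec

variable {X : Type*} [Primcodable X]

lemma primrec_wordInv {w : X → RawWord} (hw : Primrec w) : Primrec fun x => wordInv (w x) :=
  Primrec.list_reverse.comp (Primrec.list_map hw
    ((Primrec.fst.comp Primrec.snd).pair
      (Primrec.not.comp (Primrec.snd.comp Primrec.snd))).to₂)

lemma primrec_wordPow {w : X → RawWord} {n : X → ℕ} (hw : Primrec w) (hn : Primrec n) :
    Primrec fun x => wordPow (w x) (n x) :=
  Primrec.list_flatMap (Primrec.list_range.comp hn) (hw.comp Primrec.fst).to₂

lemma primrec_evaln_word {E : X → ℕ × Code} {w : X → RawWord} (hE : Primrec E)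
    (hw : Primrec w) :
    Primrec fun x => Code.evaln (E x).1 (E x).2 (Encodable.encode (w x)) :=
  Code.primrec_evaln.comp (hE.pair (Primrec.encode.comp hw))

lemma primrecPred_certTrivial {E : X → ℕ × Code} {w : X → RawWord} (hE : Primrec E)
    (hw : Primrec w) : PrimrecPred fun x => CertTrivial (E x) (w x) :=
  Primrec.eq.comp (primrec_evaln_word hE hw) (Primrec.const (some 1))

lemma primrecPred_certNontrivial {E : X → ℕ × Code} {w : X → RawWord} (hE : Primrec E)
    (hw : Primrec w) : PrimrecPred fun x => CertNontrivial (E x) (w x) :=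
  Primrec.eq.comp (primrec_evaln_word hE hw) (Primrec.const (some 0))

lemma primrecPred_letters_lt {m : X → ℕ} {w : X → RawWord} (hm : Primrec m) (hw : Primrec w) :
    PrimrecPred fun x => ∀ a ∈ w x, a.1 < m x :=
  primrecPred_forall_mem hw
    (Primrec.nat_lt.comp (Primrec.fst.comp Primrec.snd) (hm.comp Primrec.fst))

lemma primrecPred_certWords {m B : X → ℕ} {A : X → List RawWord} (hm : Primrec m)
    (hB : Primrec B) (hA : Primrec A) : PrimrecPred fun x => CertWords (m x) (B x) (A x) := by
  have hcons : ∀ b : Bool, PrimrecPred fun z : (X × RawWord) × ℕ =>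
      (z.2, b) :: z.1.2 ∈ A z.1.1 := fun b =>
    primrecPred_mem (Primrec.list_cons.comp (Primrec.snd.pair (Primrec.const b))
      (Primrec.snd.comp Primrec.fst)) (hA.comp (Primrec.fst.comp Primrec.fst))
  exact (primrecPred_mem (Primrec.const []) hA).and (primrecPred_forall_mem hA
    ((primrecPred_letters_lt (hm.comp Primrec.fst) Primrec.snd).and
      ((Primrec.nat_le.comp (hB.comp Primrec.fst) (Primrec.list_length.comp Primrec.snd)).or
        (primrecPred_forall_mem (Primrec.list_range.comp (hm.comp Primrec.fst))
          ((hcons true).and (hcons false))))))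

lemma primrecPred_certReduced {E : X → ℕ × Code} {A : X → List RawWord} {v : X → RawWord}
    (hE : Primrec E) (hA : Primrec A) (hv : Primrec v) :
    PrimrecPred fun x => CertReduced (E x) (A x) (v x) := by
  have h1 : Primrec fun z : X × RawWord => z.1 := Primrec.fst
  have h2 : Primrec fun z : (X × RawWord) × RawWord => z.1.1 := h1.comp Primrec.fst
  have h3 : Primrec fun z : ((X × RawWord) × RawWord) × RawWord => z.1.1.1 := h2.comp Primrec.fst
  have hp : Primrec fun z : (X × RawWord) × RawWord => z.1.2 := Primrec.snd.comp Primrec.fst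
  exact primrecPred_forall_mem hA (primrecPred_forall_mem (hA.comp h1)
    (primrecPred_imp (Primrec.eq.comp (Primrec.list_append.comp hp Primrec.snd) (hv.comp h2))
      (primrecPred_forall_mem (hA.comp h2)
        (primrecPred_imp
          (Primrec.nat_lt.comp (Primrec.list_length.comp Primrec.snd)
            (Primrec.list_length.comp (hv.comp h3)))
          (primrecPred_certNontrivial (hE.comp h3)
            (Primrec.list_append.comp (primrec_wordInv Primrec.snd)
              (Primrec.list_append.comp (Primrec.snd.comp Primrec.fst)
                (hp.comp Primrec.fst))))))))

lemma primrecPred_certEntry {E : X → ℕ × Code} {m B : X → ℕ} {A : X → List RawWord}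
    {t : X → RawWord × RawWord × RawWord} (hE : Primrec E) (hm : Primrec m) (hB : Primrec B)
    (hA : Primrec A) (ht : Primrec t) :
    PrimrecPred fun x => CertEntry (E x) (m x) (B x) (A x) (t x) := by
  have he : Primrec fun x => (t x).1 := Primrec.fst.comp ht
  have hv : Primrec fun x => (t x).2.1 := Primrec.fst.comp (Primrec.snd.comp ht)
  have hx : Primrec fun x => (t x).2.2 := Primrec.snd.comp (Primrec.snd.comp ht)
  exact (primrecPred_letters_lt hm he).and ((primrecPred_mem hv hA).and
    ((primrecPred_mem hx hA).and ((Primrec.nat_le.comp (Primrec.list_length.comp hv) hB).and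
      ((primrecPred_certTrivial hE (Primrec.list_append.comp he (primrec_wordInv
        (Primrec.list_append.comp (Primrec.list_append.comp hx hv) (primrec_wordInv hx))))).and
      (primrecPred_certReduced hE hA hv)))))

lemma primrecPred_certReturns {κ n : X → ℕ} {T : X → List (RawWord × RawWord × RawWord)}
    {u : X → RawWord} (hκ : Primrec κ) (hT : Primrec T) (hu : Primrec u) (hn : Primrec n) :
    PrimrecPred fun x => CertReturns (κ x) (T x) (u x) (n x) := by
  have hlen {Y : Type _} [Primcodable Y] :
      Primrec fun z : Y × (RawWord × RawWord × RawWord) => z.2.2.1.length :=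
    Primrec.list_length.comp (Primrec.fst.comp (Primrec.snd.comp Primrec.snd))
  have h1 : Primrec fun z : X × ℕ => z.1 := Primrec.fst
  exact (Primrec.nat_le.comp (Primrec.const 2) hn).and
    ((primrecPred_exists_mem hT
      ((Primrec.eq.comp (Primrec.fst.comp Primrec.snd)
        ((primrec_wordPow hu hn).comp Primrec.fst)).and
        (Primrec.nat_le.comp (hκ.comp Primrec.fst) hlen))).and
    (primrecPred_forall_mem (Primrec.list_range.comp hn)
      (primrecPred_imp (Primrec.nat_le.comp (Primrec.const 2) Primrec.snd)
        (primrecPred_exists_mem (hT.comp h1)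
          ((Primrec.eq.comp (Primrec.fst.comp Primrec.snd)
            ((primrec_wordPow (hu.comp h1) Primrec.snd).comp Primrec.fst)).and
          ((Primrec.nat_lt.comp hlen ((hκ.comp h1).comp Primrec.fst)).and
            (Primrec.nat_lt.comp (Primrec.const 0) hlen)))))))

lemma primrecPred_certNMax {E : X → ℕ × Code} {m κ N B : X → ℕ} {A : X → List RawWord}
    {T : X → List (RawWord × RawWord × RawWord)} (hE : Primrec E) (hm : Primrec m)
    (hκ : Primrec κ) (hN : Primrec N) (hB : Primrec B) (hA : Primrec A) (hT : Primrec T) :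
    PrimrecPred fun x => CertNMax (E x) (m x) (κ x) (N x) (B x) (A x) (T x) := by
  have h1 : Primrec fun z : X × RawWord => z.1 := Primrec.fst
  have h2 : Primrec fun z : (X × RawWord) × ℕ => z.1.1 := h1.comp Primrec.fst
  have ht1 : Primrec fun z : X × (RawWord × RawWord × RawWord) => z.1 := Primrec.fst
  have ht : Primrec fun z : (X × (RawWord × RawWord × RawWord)) × (RawWord × RawWord × RawWord) =>
    z.1.2 := Primrec.snd.comp Primrec.fst
  have ht' : Primrec fun z : (X × (RawWord × RawWord × RawWord)) ×
    (RawWord × RawWord × RawWord) => z.2 := Primrec.snd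
  have hu : Primrec fun z : (X × RawWord) × ℕ => z.1.2 := Primrec.snd.comp Primrec.fst
  have hshort : PrimrecPred fun z : X × RawWord => z.2.length < κ z.1 :=
    Primrec.nat_lt.comp (Primrec.list_length.comp Primrec.snd) (hκ.comp h1)
  exact (Primrec.nat_le.comp hκ hB).and ((primrecPred_certWords hm hB hA).and
    ((primrecPred_forall_mem hT (primrecPred_certEntry (hE.comp ht1) (hm.comp ht1) (hB.comp ht1)
      (hA.comp ht1) Primrec.snd)).and
    ((primrecPred_forall_mem hT (primrecPred_forall_mem (hT.comp ht1)
      ((Primrec.eq.comp (Primrec.fst.comp (Primrec.snd.comp ht))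
        (Primrec.fst.comp (Primrec.snd.comp ht'))).or
      (primrecPred_certNontrivial (hE.comp (ht1.comp Primrec.fst))
        (Primrec.list_append.comp (Primrec.fst.comp ht)
          (primrec_wordInv (Primrec.fst.comp ht'))))))).and
    ((primrecPred_forall_mem hA (primrecPred_imp hshort
      ((primrecPred_exists_mem (Primrec.list_range.comp (Primrec.succ.comp (hN.comp h1)))
        (primrecPred_certReturns (hκ.comp h2) (hT.comp h2) hu Primrec.snd)).or
      (primrecPred_exists_mem (Primrec.list_range.comp (Primrec.fst.comp (hE.comp h1)))
        (primrecPred_certTrivial (hE.comp h2)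
          (primrec_wordPow hu (Primrec.succ.comp Primrec.snd))))))).and
    ((Primrec.eq.comp hN (Primrec.const 1)).or
      (primrecPred_exists_mem hA (hshort.and
        (primrecPred_certReturns (hκ.comp h1) (hT.comp h1) Primrec.snd (hN.comp h1)))))))))

end Primrec

end Certificates

/-! ### Passing between words over `Fin m` and words on numbered letters. -/

section RawWords

variable {m : ℕ}

@[simp] lemma rawWord_append (v w : Word m) : rawWord (v ++ w) = rawWord v ++ rawWord w := by
  simp [rawWord]

@[simp] lemma rawWord_length (w : Word m) : (rawWord w).length = w.length := by
  simp [rawWord]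

@[simp] lemma rawWord_wordInv (w : Word m) : rawWord (wordInv w) = wordInv (rawWord w) := by
  simp [rawWord, wordInv, Function.comp_def]

@[simp] lemma rawWord_wordPow (w : Word m) (n : ℕ) :
    rawWord (wordPow w n) = wordPow (rawWord w) n := by
  simp [rawWord, wordPow, List.map_flatMap]

lemma rawWord_injective : Function.Injective (rawWord (m := m)) :=
  List.map_injective_iff.2 fun a b h => by
    rcases a with ⟨i, a⟩
    rcases b with ⟨j, b⟩
    simp only [Prod.mk.injEq] at h
    exact Prod.ext (Fin.ext h.1) h.2

lemma exists_rawWord_eq {w : RawWord} (hw : ∀ a ∈ w, a.1 < m) :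
    ∃ v : Word m, rawWord v = w := by
  induction w with
  | nil => exact ⟨[], rfl⟩
  | cons a w ih =>
    obtain ⟨v, rfl⟩ := ih fun b hb => hw b (List.mem_cons_of_mem _ hb)
    exact ⟨(⟨a.1, hw a List.mem_cons_self⟩, a.2) :: v, rfl⟩

lemma letters_rawWord_lt (w : Word m) : ∀ a ∈ rawWord w, a.1 < m := by
  simp only [rawWord, List.mem_map]
  rintro _ ⟨b, _, rfl⟩
  exact b.1.2

lemma length_wordPow {α : Type*} (w : List α) (n : ℕ) : (wordPow w n).length = n * w.length := by
  simp [wordPow]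

lemma wordEval_wordPow {G : Type*} [Group G] {s : Fin m → G} (w : Word m) (n : ℕ) :
    wordEval s (wordPow w n) = wordEval s w ^ n := by
  induction n with
  | zero => simp [wordPow]
  | succ n ih =>
    have : wordPow w (n + 1) = wordPow w n ++ w := by
      simp [wordPow, List.range_succ]
    rw [this, wordEval_append, ih, pow_succ]

lemma CertWords.rawWord_mem {B : ℕ} {A : List RawWord} (hA : CertWords m B A) (w : Word m)
    (hw : w.length ≤ B) : rawWord w ∈ A := by
  induction w with
  | nil => exact hA.1
  | cons a w ih =>
    rw [List.length_cons] at hw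
    have h1 := ih (by omega)
    rcases (hA.2 _ h1).2 with h2 | h2
    · rw [rawWord_length] at h2
      omega
    · have h3 := h2 a.1 (List.mem_range.2 a.1.2)
      rcases a with ⟨i, _ | _⟩
      exacts [h3.2, h3.1]

lemma CertWords.exists_rawWord {B : ℕ} {A : List RawWord} (hA : CertWords m B A) {w : RawWord}
    (hw : w ∈ A) : ∃ v : Word m, rawWord v = w :=
  exists_rawWord_eq (hA.2 w hw).1

end RawWords

/-! ### Every certificate is correct. -/

section Soundness

open Nat.Partrec (Code)

variable {G : Type*} [Group G] {m : ℕ} {s : Fin m → G} {c : Code} {F : ℕ}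

lemma SolvesWordProblem.eq_one (hc : SolvesWordProblem s c) {w : Word m}
    (h : CertTrivial (F, c) (rawWord w)) : wordEval s w = 1 := by
  by_contra hne
  have := Part.mem_unique ((hc w).2 hne) (Code.evaln_sound h)
  simp at this

lemma SolvesWordProblem.ne_one (hc : SolvesWordProblem s c) {w : Word m}
    (h : CertNontrivial (F, c) (rawWord w)) : wordEval s w ≠ 1 := by
  intro h1
  have := Part.mem_unique ((hc w).1 h1) (Code.evaln_sound h)
  simp at this

lemma CertReduced.isCyclicallyReduced (hs : Subgroup.closure (Set.range s) = ⊤)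
    (hc : SolvesWordProblem s c) {B : ℕ} {A : List RawWord} (hA : CertWords m B A)
    {v : Word m} (hvB : v.length ≤ B) (hv : CertReduced (F, c) A (rawWord v)) :
    IsCyclicallyReduced s v := by
  rintro w' ⟨i, rfl⟩
  rw [List.rotate_eq_drop_append_take_mod]
  set j := i % v.length
  obtain ⟨z, hz, hze⟩ := exists_geodesic_word hs (wordEval s (v.drop j ++ v.take j))
  refine le_antisymm (wordLength_wordEval_le _) ?_
  by_contra! hlt
  have hlen : (v.drop j ++ v.take j).length = v.length := by
    rw [List.length_append, add_comm, ← List.length_append, List.take_append_drop]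
  rw [← hz, hlen] at hlt
  have h1 := hv (rawWord (v.take j)) (hA.rawWord_mem _ (by rw [List.length_take]; omega))
    (rawWord (v.drop j)) (hA.rawWord_mem _ (by rw [List.length_drop]; omega))
    (by rw [← rawWord_append, List.take_append_drop])
    (rawWord z) (hA.rawWord_mem _ (by omega)) (by simpa using hlt)
  rw [← rawWord_wordInv, ← rawWord_append, ← rawWord_append] at h1
  exact hc.ne_one h1 (by rw [wordEval_append, wordEval_wordInv, hze, inv_mul_cancel])

lemma CertEntry.exists_words (hs : Subgroup.closure (Set.range s) = ⊤)
    (hc : SolvesWordProblem s c) {B : ℕ} {A : List RawWord} (hA : CertWords m B A)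
    {t : RawWord × RawWord × RawWord} (ht : CertEntry (F, c) m B A t) :
    ∃ e v : Word m, rawWord e = t.1 ∧ rawWord v = t.2.1 ∧ IsCyclicallyReduced s v ∧
      IsConj (wordEval s e) (wordEval s v) := by
  obtain ⟨h1, h2, h3, h4, h5, h6⟩ := ht
  obtain ⟨e, he⟩ := exists_rawWord_eq h1
  obtain ⟨v, hv⟩ := hA.exists_rawWord h2
  obtain ⟨x, hx⟩ := hA.exists_rawWord h3
  rw [← hv, rawWord_length] at h4
  rw [← hv] at h6
  refine ⟨e, v, he, hv, h6.isCyclicallyReduced hs hc hA h4, IsConj.symm (isConj_iff.2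
    ⟨wordEval s x, ?_⟩)⟩
  rw [← he, ← hv, ← hx] at h5
  simp only [← rawWord_wordInv, ← rawWord_append] at h5
  have h7 := hc.eq_one h5
  simp only [wordEval_append, wordEval_wordInv] at h7
  rw [mul_inv_eq_one.1 h7]

/-- The table fixes finitely many values of $\rho$; elsewhere an arbitrary cyclic reduction is used.
The ball entries decide every search that matters, either by its result or by a finite order, which
excludes a result. -/
lemma CertNMax.exists_isNMax (hs : Subgroup.closure (Set.range s) = ⊤)
    (hc : SolvesWordProblem s c) {κ N B : ℕ} {A : List RawWord}
    {T : List (RawWord × RawWord × RawWord)} (h : CertNMax (F, c) m κ N B A T) (hκ : 0 < κ)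
    {lam eps : ℝ} (hlam : 1 ≤ lam) (hq : LocalGeodesicsQuasi s κ lam eps) :
    ∃ ρ : G → Word m, IsCyclicReduction s ρ ∧ IsNMax s κ ρ N := by
  classical
  obtain ⟨hκB, hA, hT, hcons, hball, hN⟩ := h
  obtain ⟨ρ₀, hρ₀⟩ := exists_isCyclicReduction hs
  -- the table extends to a cyclic reduction
  obtain ⟨ρ, hρ, hρT⟩ : ∃ ρ : G → Word m, IsCyclicReduction s ρ ∧
      ∀ t ∈ T, ∀ e : Word m, rawWord e = t.1 → rawWord (ρ (wordEval s e)) = t.2.1 := by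
    have hex : ∀ g : G, ∃ w : Word m, (IsCyclicallyReduced s w ∧ IsConj g (wordEval s w)) ∧
        ∀ t ∈ T, ∀ e : Word m, rawWord e = t.1 → wordEval s e = g → rawWord w = t.2.1 := by
      intro g
      by_cases hg : ∃ t ∈ T, ∃ e : Word m, rawWord e = t.1 ∧ wordEval s e = g
      · obtain ⟨t, ht, e, he, rfl⟩ := hg
        obtain ⟨e', v, he', hv, hred, hconj⟩ := (hT t ht).exists_words hs hc hA
        obtain rfl := rawWord_injective (he'.trans he.symm)
        refine ⟨v, ⟨hred, hconj⟩, fun t' ht' f hf hfe => ?_⟩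
        -- Different words in the table may represent one element; the consistency condition then
        -- forces equal reductions.
        rcases hcons t ht t' ht' with h1 | h1
        · rw [hv, h1]
        · rw [← he, ← hf, ← rawWord_wordInv, ← rawWord_append] at h1
          exact absurd (by rw [wordEval_append, wordEval_wordInv, hfe, mul_inv_cancel])
            (hc.ne_one h1)
      · push Not at hg
        exact ⟨ρ₀ g, hρ₀ g, fun t ht e he hge => absurd hge (hg t ht e he)⟩
    choose ρ h1 h2 using hex
    exact ⟨ρ, h1, fun t ht e he => h2 _ t ht e he rfl⟩
  have hret : ∀ (u : Word m) (n : ℕ), CertReturns κ T (rawWord u) n →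
      SearchReturns κ ρ (wordEval s u) n := by
    rintro u n ⟨h1, ⟨t, ht, hte, htl⟩, h3⟩
    have hlen : ∀ t ∈ T, ∀ i, t.1 = wordPow (rawWord u) i →
        (ρ (wordEval s u ^ i)).length = t.2.1.length := fun t ht i hti => by
      rw [← hρT t ht (wordPow u i) (by rw [hti, rawWord_wordPow]), rawWord_length,
        wordEval_wordPow]
    refine ⟨h1, by rwa [hlen t ht n hte], fun i hi2 hin => ?_⟩
    obtain ⟨t', ht', hte', h5, h6⟩ := h3 i (List.mem_range.2 hin) hi2
    rw [SearchStopsAt, hlen t' ht' i hte']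
    omega
  refine ⟨ρ, hρ, ?_, ?_⟩
  · rcases hN with rfl | ⟨u, hu, huκ, hret'⟩
    · exact Or.inl rfl
    · obtain ⟨u, rfl⟩ := hA.exists_rawWord hu
      rw [rawWord_length] at huκ
      have := wordLength_wordEval_le (s := s) u
      exact Or.inr ⟨wordEval s u, by omega, hret u N hret'⟩
  · rintro n (hn | ⟨g, hg, hn⟩)
    · rw [Set.mem_singleton_iff] at hn
      rcases hN with rfl | ⟨u, _, _, h2, _⟩ <;> omega
    · obtain ⟨u, hu, rfl⟩ := exists_geodesic_word hs g
      rcases hball (rawWord u) (hA.rawWord_mem u (by omega))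
        (by rw [rawWord_length]; omega) with ⟨n', hn', h⟩ | ⟨n', _, h⟩
      · rw [hn.unique (hret u n' h)]
        exact Nat.lt_succ_iff.1 (List.mem_range.1 hn')
      · rw [← rawWord_wordPow] at h
        have h1 := hc.eq_one h
        rw [wordEval_wordPow] at h1
        exact absurd (isOfFinOrder_iff_pow_eq_one.2 ⟨n' + 1, Nat.succ_pos _, h1⟩)
          (hn.not_isOfFinOrder hs hρ hκ hlam hq)

end Soundness

/-! ### A certificate exists. -/

section Completeness

open Nat.Partrec (Code)

variable {G : Type*} [Group G] {m : ℕ} {s : Fin m → G} {c : Code}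

/-- For finitely many words a common running time suffices. -/
lemma SolvesWordProblem.exists_time (hc : SolvesWordProblem s c) (Q F₀ : ℕ) :
    ∃ F, F₀ ≤ F ∧ ∀ w : Word m, w.length ≤ Q →
      (wordEval s w = 1 → CertTrivial (F, c) (rawWord w)) ∧
      (wordEval s w ≠ 1 → CertNontrivial (F, c) (rawWord w)) := by
  have hex : ∀ w : Word m, ∃ F, (wordEval s w = 1 → CertTrivial (F, c) (rawWord w)) ∧
      (wordEval s w ≠ 1 → CertNontrivial (F, c) (rawWord w)) := fun w => by
    by_cases hw : wordEval s w = 1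
    · obtain ⟨F, hF⟩ := Code.evaln_complete.1 ((hc w).1 hw)
      exact ⟨F, fun _ => hF, fun h => absurd hw h⟩
    · obtain ⟨F, hF⟩ := Code.evaln_complete.1 ((hc w).2 hw)
      exact ⟨F, fun h => absurd h hw, fun _ => hF⟩
  choose F hF using hex
  obtain ⟨b, hb⟩ := ((List.finite_length_le (Fin m × Bool) Q).image F).bddAbove
  refine ⟨max F₀ b, le_max_left _ _, fun w hw => ?_⟩
  have hle : F w ≤ max F₀ b := le_max_of_le_right (hb ⟨w, hw, rfl⟩)
  exact ⟨fun h => Code.evaln_mono hle ((hF w).1 h), fun h => Code.evaln_mono hle ((hF w).2 h)⟩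

/-- All words of length at most `B`. -/
noncomputable def allWords (m B : ℕ) : List (Word m) :=
  (List.finite_length_le (Fin m × Bool) B).toFinset.toList

lemma mem_allWords {B : ℕ} {w : Word m} : w ∈ allWords m B ↔ w.length ≤ B := by
  simp [allWords]

lemma certWords_allWords (m B : ℕ) : CertWords m B ((allWords m B).map rawWord) := by
  refine ⟨List.mem_map.2 ⟨[], mem_allWords.2 (Nat.zero_le _), rfl⟩, fun w hw => ?_⟩
  obtain ⟨w, hw, rfl⟩ := List.mem_map.1 hw
  refine ⟨letters_rawWord_lt w, or_iff_not_imp_left.2 fun h i hi => ?_⟩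
  rw [rawWord_length, not_le] at h
  rw [List.mem_range] at hi
  exact ⟨List.mem_map.2 ⟨(⟨i, hi⟩, true) :: w, mem_allWords.2 h, rfl⟩,
    List.mem_map.2 ⟨(⟨i, hi⟩, false) :: w, mem_allWords.2 h, rfl⟩⟩

/-- The table lists $\rho$, with conjugators, on the powers $u^i$ with $i\le N$ of all short words
$u$. Only finitely many words are ever tested, so one running time serves for all. -/
lemma IsNMax.exists_certNMax (hs : Subgroup.closure (Set.range s) = ⊤)
    (hc : SolvesWordProblem s c) {κ N : ℕ} (hκ : 0 < κ) {ρ : G → Word m}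
    (hρ : IsCyclicReduction s ρ) (hN : IsNMax s κ ρ N)
    (hret : ∀ g : G, ¬ IsOfFinOrder g → ∃ n, SearchReturns κ ρ g n) :
    ∃ F B A T, CertNMax (F, c) m κ N B A T := by
  have hconj : ∀ g : G, ∃ x : Word m,
      wordEval s x * wordEval s (ρ g) * (wordEval s x)⁻¹ = g := fun g => by
    obtain ⟨y, hy⟩ := isConj_iff.1 (hρ g).2.symm
    obtain ⟨x, rfl⟩ := exists_wordEval_eq hs y
    exact ⟨x, hy⟩
  choose χ hχ using hconj
  have hord : ∀ g : G, ∃ n : ℕ, IsOfFinOrder g → g ^ (n + 1) = 1 := fun g => by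
    by_cases hg : IsOfFinOrder g
    · obtain ⟨i, hi, h1⟩ := isOfFinOrder_iff_pow_eq_one.1 hg
      exact ⟨i - 1, fun _ => by rwa [Nat.sub_add_cancel hi]⟩
    · exact ⟨0, fun h => absurd h hg⟩
  choose o ho using hord
  set T₀ : List (Word m × Word m × Word m) := (allWords m κ).flatMap fun u =>
    (List.range (N + 1)).map fun i =>
      (wordPow u i, ρ (wordEval s u ^ i), χ (wordEval s u ^ i)) with hT₀
  have hmemT : ∀ u : Word m, u.length < κ → ∀ i ≤ N,
      (wordPow u i, ρ (wordEval s u ^ i), χ (wordEval s u ^ i)) ∈ T₀ := fun u hu i hi => by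
    rw [hT₀, List.mem_flatMap]
    exact ⟨u, mem_allWords.2 hu.le, List.mem_map.2 ⟨i, List.mem_range.2 (by omega), rfl⟩⟩
  have hT₀eq : ∀ t ∈ T₀, t.2.1 = ρ (wordEval s t.1) ∧ t.2.2 = χ (wordEval s t.1) := by
    intro t ht
    rw [hT₀, List.mem_flatMap] at ht
    obtain ⟨u, _, hu⟩ := ht
    obtain ⟨i, _, rfl⟩ := List.mem_map.1 hu
    simp [wordEval_wordPow]
  -- a bound for the lengths of all words and exponents that occur
  obtain ⟨L, hLκ, hLT, hLo⟩ : ∃ L, κ ≤ L ∧ (∀ t ∈ T₀, t.1.length ≤ L ∧ t.2.1.length ≤ L ∧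
      t.2.2.length ≤ L) ∧ ∀ u : Word m, u.length ≤ κ → o (wordEval s u) ≤ L := by
    obtain ⟨a, ha⟩ := ((List.finite_toSet T₀).image fun t => t.1.length + t.2.1.length +
      t.2.2.length).bddAbove
    obtain ⟨b, hb⟩ := ((List.finite_length_le (Fin m × Bool) κ).image
      fun u => o (wordEval s u)).bddAbove
    refine ⟨κ + a + b, by omega, fun t ht => ?_, fun u hu => ?_⟩
    · have : t.1.length + t.2.1.length + t.2.2.length ≤ a := ha ⟨t, ht, rfl⟩
      omega
    · have : o (wordEval s u) ≤ b := hb ⟨u, hu, rfl⟩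
      omega
  -- The words $e(xvx^{-1})^{-1}$ have length at most $4L$, and the powers certifying finite order
  -- at most $(L+1)L$. The running time also bounds the exponents tried for finite order, hence
  -- $F\ge L+1$.
  obtain ⟨F, hLF, hF⟩ := hc.exists_time (4 * L + (L + 1) * L) (L + 1)
  have hA := certWords_allWords m L
  have hmemA : ∀ w : RawWord, w ∈ (allWords m L).map rawWord →
      ∃ v : Word m, v.length ≤ L ∧ rawWord v = w := fun w hw => by
    obtain ⟨v, hv, rfl⟩ := List.mem_map.1 hw
    exact ⟨v, mem_allWords.1 hv, rfl⟩
  have hred : ∀ v : Word m, v.length ≤ L → IsCyclicallyReduced s v →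
      CertReduced (F, c) ((allWords m L).map rawWord) (rawWord v) := by
    intro v hvL hv p hp q hq hpq z hz hzl
    obtain ⟨p, _, rfl⟩ := hmemA p hp
    obtain ⟨q, _, rfl⟩ := hmemA q hq
    obtain ⟨z, _, rfl⟩ := hmemA z hz
    rw [← rawWord_append] at hpq
    obtain rfl := rawWord_injective hpq
    rw [← rawWord_wordInv, ← rawWord_append, ← rawWord_append]
    simp only [rawWord_length, List.length_append] at hzl hvL
    refine (hF _ ?_).2 fun h1 => ?_
    · simp only [List.length_append, wordInv_length]
      omega
    · rw [wordEval_append, wordEval_wordInv, inv_mul_eq_one] at h1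
      have h2 := hv (q ++ p) List.isRotated_append
      have h3 := wordLength_wordEval_le (s := s) z
      rw [← h1, List.length_append] at h2
      omega
  set T : List (RawWord × RawWord × RawWord) :=
    T₀.map fun t => (rawWord t.1, rawWord t.2.1, rawWord t.2.2) with hT
  have hcert : ∀ (u : Word m) (n : ℕ), u.length < κ → n ≤ N →
      SearchReturns κ ρ (wordEval s u) n → CertReturns κ T (rawWord u) n := by
    intro u n hu hn ⟨h1, h2, h3⟩
    refine ⟨h1, ⟨_, List.mem_map.2 ⟨_, hmemT u hu n hn, rfl⟩, rawWord_wordPow u n, by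
      simpa using h2⟩, fun i hi hi2 => ?_⟩
    rw [List.mem_range] at hi
    have h4 := h3 i hi2 hi
    rw [SearchStopsAt] at h4
    refine ⟨_, List.mem_map.2 ⟨_, hmemT u hu i (by omega), rfl⟩, rawWord_wordPow u i, ?_, ?_⟩ <;>
      simp only [rawWord_length] <;> omega
  refine ⟨F, L, (allWords m L).map rawWord, T, hLκ, hA, ?_, ?_, ?_, ?_⟩
  · intro t ht
    obtain ⟨t, ht₀, rfl⟩ := List.mem_map.1 ht
    obtain ⟨l1, l2, l3⟩ := hLT t ht₀
    obtain ⟨e1, e2⟩ := hT₀eq t ht₀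
    refine ⟨letters_rawWord_lt _, hA.rawWord_mem _ l2, hA.rawWord_mem _ l3,
      by simpa using l2, ?_, hred _ l2 (e1 ▸ (hρ _).1)⟩
    simp only [← rawWord_wordInv, ← rawWord_append]
    refine (hF _ ?_).1 ?_
    · simp only [List.length_append, wordInv_length]
      omega
    · simp only [wordEval_append, wordEval_wordInv, e1, e2, hχ, mul_inv_cancel]
  · intro t ht t' ht'
    obtain ⟨t, ht₀, rfl⟩ := List.mem_map.1 ht
    obtain ⟨t', ht₀', rfl⟩ := List.mem_map.1 ht'
    have l1 := (hLT t ht₀).1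
    have l2 := (hLT t' ht₀').1
    by_cases h : wordEval s t.1 = wordEval s t'.1
    · left
      simp only [(hT₀eq t ht₀).1, (hT₀eq t' ht₀').1, h]
    · right
      simp only [← rawWord_wordInv, ← rawWord_append]
      refine (hF _ ?_).2 ?_
      · simp only [List.length_append, wordInv_length]
        omega
      · rwa [wordEval_append, wordEval_wordInv, Ne, mul_inv_eq_one]
  · intro u hu huκ
    obtain ⟨u, _, rfl⟩ := hmemA u hu
    rw [rawWord_length] at huκ
    by_cases hg : IsOfFinOrder (wordEval s u)
    · right
      have h1 := hLo u huκ.le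
      refine ⟨o (wordEval s u), List.mem_range.2 (by omega), ?_⟩
      rw [← rawWord_wordPow]
      refine (hF _ ?_).1 (by rw [wordEval_wordPow, ho _ hg])
      rw [length_wordPow]
      have := Nat.mul_le_mul (Nat.succ_le_succ h1) (huκ.le.trans hLκ)
      simp only [Nat.succ_eq_add_one] at this
      omega
    · left
      obtain ⟨n, hn⟩ := hret _ hg
      have hnN : n ≤ N := hN.2 (Or.inr ⟨wordEval s u, by
        have := wordLength_wordEval_le (s := s) u
        omega, hn⟩)
      exact ⟨n, List.mem_range.2 (by omega), hcert u n huκ hnN hn⟩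
  · rcases hN.1 with h | ⟨g, hg, hn⟩
    · exact Or.inl h
    · right
      obtain ⟨u, hu, rfl⟩ := exists_geodesic_word hs g
      exact ⟨rawWord u, hA.rawWord_mem u (by omega), by rw [rawWord_length]; omega,
        hcert u N (by omega) le_rfl hn⟩

end Completeness

/-! ### The unbounded search for a certificate. -/

section Algorithm

open Nat.Partrec (Code)

/-- The data of a certificate: a running time, the value `n_max`, a bound for the length of
words, a list of words and a table of cyclic reductions. -/
abbrev CertData := ℕ × ℕ × ℕ × List RawWord × List (RawWord × RawWord × RawWord)

/-- `d` is a certificate for the program, the rank and the length bound in `x`. -/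
def IsCertificate (x : Code × ℕ × ℕ) (d : CertData) : Prop :=
  CertNMax (d.1, x.1) x.2.1 (8 * x.2.2 + 4) d.2.1 d.2.2.1 d.2.2.2.1 d.2.2.2.2

lemma primrecPred_isCertificate :
    PrimrecPred fun z : (Code × ℕ × ℕ) × CertData => IsCertificate z.1 z.2 := by
  have h2 : Primrec fun z : (Code × ℕ × ℕ) × CertData => z.2.2 := Primrec.snd.comp Primrec.snd
  have h22 : Primrec fun z : (Code × ℕ × ℕ) × CertData => z.2.2.2 := Primrec.snd.comp h2
  have h222 : Primrec fun z : (Code × ℕ × ℕ) × CertData => z.2.2.2.2 := Primrec.snd.comp h22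
  have h1 : Primrec fun z : (Code × ℕ × ℕ) × CertData => z.1.2 := Primrec.snd.comp Primrec.fst
  exact primrecPred_certNMax ((Primrec.fst.comp Primrec.snd).pair (Primrec.fst.comp Primrec.fst))
    (Primrec.fst.comp h1) (Primrec.nat_add.comp (Primrec.nat_mul.comp (Primrec.const 8)
      (Primrec.snd.comp h1)) (Primrec.const 4)) (Primrec.fst.comp h2) (Primrec.fst.comp h22)
    (Primrec.fst.comp h222) (Primrec.snd.comp h222)

open Classical in
/-- The output obtained from the certificate with a given code, if it is one. -/
noncomputable def certOutput (x : Code × ℕ × ℕ) (n : ℕ) : Option (ℕ × ℕ) :=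
  (Encodable.decode (α := CertData) n).bind fun d =>
    if IsCertificate x d then some (8 * x.2.2 + 4, 2 * d.2.1) else none

lemma primrec_certOutput : Primrec₂ certOutput := by
  classical
  have hout : Primrec fun z : ((Code × ℕ × ℕ) × ℕ) × CertData =>
      some (8 * z.1.1.2.2 + 4, 2 * z.2.2.1) :=
    Primrec.option_some.comp ((Primrec.nat_add.comp (Primrec.nat_mul.comp (Primrec.const 8)
      (Primrec.snd.comp (Primrec.snd.comp (Primrec.fst.comp Primrec.fst)))) (Primrec.const 4)).pair
      (Primrec.nat_mul.comp (Primrec.const 2) (Primrec.fst.comp (Primrec.snd.comp Primrec.snd))))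
  exact Primrec.option_bind (Primrec.decode.comp Primrec.snd)
    (Primrec.ite (primrecPred_isCertificate.comp
      ((Primrec.fst.comp Primrec.fst).pair Primrec.snd)) hout (Primrec.const none)).to₂

/-- The algorithm searches for a certificate. -/
noncomputable def stableNormAlgorithm (x : Code × ℕ × ℕ) : Part (ℕ × ℕ) :=
  Nat.rfindOpt (certOutput x)

lemma partrec_stableNormAlgorithm : Partrec stableNormAlgorithm :=
  Partrec.rfindOpt primrec_certOutput.to_comp

lemma exists_isCertificate_of_mem {x : Code × ℕ × ℕ} {r : ℕ × ℕ}
    (h : r ∈ stableNormAlgorithm x) :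
    ∃ d, IsCertificate x d ∧ r = (8 * x.2.2 + 4, 2 * d.2.1) := by
  obtain ⟨n, hn⟩ := Nat.rfindOpt_spec h
  obtain ⟨d, _, hd⟩ := Option.bind_eq_some_iff.1 hn
  split_ifs at hd with hcert
  exact ⟨d, hcert, (Option.some_inj.1 hd).symm⟩

lemma stableNormAlgorithm_dom {x : Code × ℕ × ℕ} {d : CertData} (h : IsCertificate x d) :
    (stableNormAlgorithm x).Dom := by
  refine Nat.rfindOpt_dom.2 ⟨Encodable.encode d, (8 * x.2.2 + 4, 2 * d.2.1), ?_⟩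
  simp [certOutput, h]

end Algorithm

end WordHyp

theorem mainTheorem1 :
    -- computable constants `k, lam, eps` and an algorithm `K` producing a fraction
    ∃ (k lam eps : ℕ → ℕ) (K : Nat.Partrec.Code × ℕ × ℕ →. ℕ × ℕ),
      Computable k ∧ Computable lam ∧ Computable eps ∧ Partrec K ∧
      (∀ δ : ℕ, 0 < k δ ∧ 1 ≤ lam δ) ∧
      ∀ (G : Type*) [Group G] (m : ℕ) (s : Fin m → G),
        Subgroup.closure (Set.range s) = ⊤ →
        ∀ δ : ℕ, IsDeltaHyperbolic s (δ : ℝ) →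
          -- the limit that defines the stable norm exists
          (∀ g : G, ¬ IsOfFinOrder g →
            Tendsto (fun n : ℕ => (wordLength s (g ^ n) : ℝ) / n) atTop (𝓝 (stableNorm s g))) ∧
          LocalGeodesicsQuasi s (k δ) (lam δ) (eps δ) ∧
          -- the word problem is solvable, and `K = k / (lam * n_max)` is computed from a solution
          (∃ c : Nat.Partrec.Code, SolvesWordProblem s c) ∧
          (∀ c : Nat.Partrec.Code, SolvesWordProblem s c →
            ∃ a b : ℕ, (a, b) ∈ K (c, m, δ) ∧ 0 < a ∧ 0 < b ∧
              (∃ (ρ : G → Word m) (N : ℕ), IsCyclicReduction s ρ ∧ IsNMax s (k δ) ρ N ∧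
                (a : ℝ) / b = k δ / (lam δ * N)) ∧
              ∀ g : G, ¬ IsOfFinOrder g → (a : ℝ) / b ≤ stableNorm s g) ∧
          -- the search and the explicit bound, for all admissible constants
          (∀ (k' : ℕ) (lam' eps' : ℝ), 0 < k' → 1 ≤ lam' → 0 ≤ eps' →
            LocalGeodesicsQuasi s k' lam' eps' →
            ∀ ρ : G → Word m, IsCyclicReduction s ρ →
              (∀ g : G, wordLength s g ≤ k' - 1 →
                (∃ i : ℕ, 2 ≤ i ∧ SearchStopsAt k' ρ g i) ∧
                ((∃ n : ℕ, SearchReturns k' ρ g n) ↔ ¬ IsOfFinOrder g)) ∧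
              ∃ N : ℕ, IsNMax s k' ρ N ∧ 0 < (k' : ℝ) / (lam' * N) ∧
                ∀ g : G, ¬ IsOfFinOrder g → (k' : ℝ) / (lam' * N) ≤ stableNorm s g) := by
  have hlin : ∀ a b : ℕ, Computable fun δ : ℕ => a * δ + b := fun a b =>
    (Primrec.nat_add.comp (Primrec.nat_mul.comp (Primrec.const a) Primrec.id)
      (Primrec.const b)).to_comp
  refine ⟨fun δ => 8 * δ + 4, fun _ => 2, fun δ => 12 * δ + 6, stableNormAlgorithm, hlin 8 4,
    Computable.const 2, hlin 12 6, partrec_stableNormAlgorithm, fun δ => ⟨by simp, by simp⟩, ?_⟩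
  intro G _ m s hs δ hδ
  have hq : LocalGeodesicsQuasi s (8 * δ + 4) ((2 : ℕ) : ℝ) ((12 * δ + 6 : ℕ) : ℝ) := by
    rw [Nat.cast_ofNat]
    exact hδ.localGeodesicsQuasi hs
  have hlam : (1 : ℝ) ≤ ((2 : ℕ) : ℝ) := by norm_num
  refine ⟨fun g _ => tendsto_stableNorm hs g, hq, exists_solvesWordProblem hs hq, ?_, ?_⟩
  · intro c hc
    -- This `ρ₀` only shows that the algorithm halts. The certificate found may be a different one,
    -- and soundness supplies its own `ρ`.
    obtain ⟨ρ₀, hρ₀⟩ := exists_isCyclicReduction hs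
    obtain ⟨N₀, hN₀⟩ := exists_isNMax hs (8 * δ + 4) ρ₀
    obtain ⟨F, B, A, T, hcert⟩ := hN₀.exists_certNMax hs hc (by omega) hρ₀
      fun g hg => hδ.exists_searchReturns hs hρ₀ hg _
    have hdom := stableNormAlgorithm_dom (x := (c, m, δ)) (d := (F, N₀, B, A, T)) hcert
    obtain ⟨d, hd, hout⟩ := exists_isCertificate_of_mem (Part.get_mem hdom)
    obtain ⟨ρ, hρ, hN⟩ := CertNMax.exists_isNMax hs hc hd (by simp) hlam hq
    refine ⟨8 * δ + 4, 2 * d.2.1, hout ▸ Part.get_mem hdom, by omega,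
      Nat.mul_pos two_pos hN.pos, ⟨ρ, d.2.1, hρ, hN, by rw [Nat.cast_mul]⟩, fun g hg => ?_⟩
    rw [Nat.cast_mul]
    exact hδ.div_le_stableNorm hs hρ (by omega) hlam hq hN hg
  · intro k' lam' eps' hk hlam' _ hq' ρ hρ
    refine ⟨fun g _ => ⟨hδ.exists_searchStopsAt hs hρ k' g,
      fun ⟨n, hn⟩ => hn.not_isOfFinOrder hs hρ hk hlam' hq',
      fun hg => hδ.exists_searchReturns hs hρ hg k'⟩, ?_⟩
    obtain ⟨N, hN⟩ := exists_isNMax hs k' ρ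
    refine ⟨N, hN, ?_, fun g hg => hδ.div_le_stableNorm hs hρ hk hlam' hq' hN hg⟩
    have h1 : (0 : ℝ) < k' := by exact_mod_cast hk
    have h2 : (0 : ℝ) < N := by exact_mod_cast hN.pos
    have h3 : (0 : ℝ) < lam' := by linarith
    positivity
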